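/- Let $\mathbb{K}$ be a field. A (non-associative) $\mathbb{K}$-algebra is a $\mathbb{K}$-vector space with a bilinear multiplication; algebra morphisms are the linear maps that preserve the multiplication. Let $I$ be a set of non-associative polynomials over $\mathbb{K}$ (elements of the free $\mathbb{K}$-algebra on a set of variables), each of which is homogeneous, i.e. in all of its monomials each variable occurs the same number of times. Let $\mathcal{V}$ be the homogeneous variety determined by $I$: the category of all $\mathbb{K}$-algebras in which every element of $I$ vanishes under every substitution. An identity of $\mathcal V$ is an equation that holds for all elements of all algebras in $\mathcal V$. Write $+$ and $\times$ for coproducts and products in $\mathcal{V}$, and $\iota_X$, $\iota_Y$, $\iota_Z$ for coproduct inclusions. For $X$, $Y$, $Z$ in $\mathcal{V}$, the binary cosmash product $X\diamond Y$ is the kernel of the canonical morphism $\Sigma_{X,Y}\colon X+Y\to X\times Y$ with components $\langle 1_X,0\rangle$ and $\langle 0,1_Y\rangle$, with inclusion $\iota_{X,Y}\colon X\diamond Y\to X+Y$. The ternary cosmash product $X\diamond Y\diamond Z$ is the kernel of the morphism $\Sigma_{X,Y,Z}\colon X+Y+Z\to (X+Y)\times(X+Z)\times(Y+Z)$ with components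 $\langle\iota_X,\iota_Y,0\rangle$, $\langle\iota_X,0,\iota_Z\rangle$ and $\langle 0,\iota_Y,\iota_Z\rangle$. The comparison map $\Phi_{X,Y,Z}\colon X\diamond(Y\diamond Z)\to X\diamond Y\diamond Z$ is the restriction of $1_X+\iota_{Y,Z}\colon X+(Y\diamond Z)\to X+(Y+Z)$ to these kernels. **Proposition 7.1.** The comparison map $\Phi_{X,Y,Z}\colon X\diamond(Y\diamond Z)\to X\diamond Y\diamond Z$ is surjective for all algebras $X$, $Y$, $Z$ in $\mathcal{V}$ if and only if there exist elements $\alpha_i,\beta_i,\gamma_i,\delta_i\in\mathbb{K}$, $i\in\{1,2,3,4\}$, for which $$\begin{cases} (xy)z=\alpha_1x(yz)+\alpha_2x(zy)+\alpha_3(yz)x+\alpha_4(zy)x\\ (yx)z=\beta_1x(yz)+\beta_2x(zy)+\beta_3(yz)x+\beta_4(zy)x\\ z(xy)=\gamma_1x(yz)+\gamma_2x(zy)+\gamma_3(yz)x+\gamma_4(zy)x\\ z(yx)=\delta_1x(yz)+\delta_2x(zy)+\delta_3(yz)x+\delta_4(zy)x \end{cases}$$ are identities of $\mathcal{V}$.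 -/

import Mathlib

universe u v w

namespace Cosmash

set_option linter.unusedSectionVars false

/-! ### Non-associative polynomials, identities and varieties

A (non-associative) `K`-algebra is a `K`-vector space with a bilinear multiplication.
Non-associative polynomials with variables in `σ` are the elements of the magma algebra
`FreeNonUnitalNonAssocAlgebra K σ = K[M(σ)]`, the free `K`-algebra on `σ`. -/

section Identities

variable {K : Type*} [Field K] {σ : Type*}

/-- The type of a non-associative word: the multiset of its letters, recording how many times each
variable occurs. -/
def wordType : FreeMagma σ → Multiset σ
  | FreeMagma.of x => {x}
  | FreeMagma.mul v w => wordType v + wordType w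

/-- A non-associative polynomial is homogeneous if all its monomials are of the same type. -/
def IsHomogeneous (φ : FreeNonUnitalNonAssocAlgebra K σ) : Prop :=
  ∀ v ∈ φ.coeff.support, ∀ w ∈ φ.coeff.support, wordType v = wordType w

/-- `φ` is an identity of the algebra `A`: it vanishes under every substitution of elements of `A`
for its variables. -/
def IsIdentity (A : Type*) [NonUnitalNonAssocRing A] [Module K A] [IsScalarTower K A A]
    [SMulCommClass K A A] (φ : FreeNonUnitalNonAssocAlgebra K σ) : Prop :=
  ∀ a : σ → A, FreeNonUnitalNonAssocAlgebra.lift K a φ = 0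

theorem comp_lift {A B : Type*} [NonUnitalNonAssocRing A] [Module K A] [IsScalarTower K A A]
    [SMulCommClass K A A] [NonUnitalNonAssocRing B] [Module K B] [IsScalarTower K B B]
    [SMulCommClass K B B] (f : A →ₙₐ[K] B) (a : σ → A) (φ : FreeNonUnitalNonAssocAlgebra K σ) :
    f (FreeNonUnitalNonAssocAlgebra.lift K a φ) =
      FreeNonUnitalNonAssocAlgebra.lift K (fun i => f (a i)) φ := by
  have h : f.comp (FreeNonUnitalNonAssocAlgebra.lift K a) =
      FreeNonUnitalNonAssocAlgebra.lift K (fun i => f (a i)) := by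
    apply FreeNonUnitalNonAssocAlgebra.hom_ext
    intro x
    simp
  exact DFunLike.congr_fun h φ

end Identities

/-- The objects of the variety of `K`-algebras determined by a set `I` of non-associative
polynomials: the `K`-algebras of which all elements of `I` are identities. The morphisms between
two such objects `A` and `B` are the `K`-algebra morphisms `A →ₙₐ[K] B`. -/
structure VarietyAlgebra {K : Type u} [Field K] {σ : Type w}
    (I : Set (FreeNonUnitalNonAssocAlgebra K σ)) where
  carrier : Type (max u v)
  [ring : NonUnitalNonAssocRing carrier]
  [module : Module K carrier]
  [scalarTower : IsScalarTower K carrier carrier]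
  [smulComm : SMulCommClass K carrier carrier]
  isIdentity : ∀ φ ∈ I, IsIdentity carrier φ

attribute [instance] VarietyAlgebra.ring VarietyAlgebra.module VarietyAlgebra.scalarTower
  VarietyAlgebra.smulComm

instance {K : Type u} [Field K] {σ : Type w} (I : Set (FreeNonUnitalNonAssocAlgebra K σ)) :
    CoeSort (VarietyAlgebra.{u, v, w} I) (Type (max u v)) :=
  ⟨VarietyAlgebra.carrier⟩

/-! ### Quotients of algebras -/

section Quotients

variable {K : Type*} [Field K] {F : Type*} [NonUnitalNonAssocRing F] [Module K F]
  [IsScalarTower K F F] [SMulCommClass K F F]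

/-- A linear subspace which is closed under multiplication, on either side, by arbitrary
elements. -/
def IsAlgebraIdeal (N : Submodule K F) : Prop :=
  ∀ x : F, ∀ n ∈ N, x * n ∈ N ∧ n * x ∈ N

/-- The ideal generated by a subset of an algebra. -/
def idealSpan (K : Type*) [Field K] {F : Type*} [NonUnitalNonAssocRing F] [Module K F]
    (S : Set F) : Submodule K F :=
  sInf {N : Submodule K F | S ⊆ N ∧ IsAlgebraIdeal N}

theorem subset_idealSpan (S : Set F) : S ⊆ idealSpan K S := by
  intro s hs
  simp only [idealSpan, SetLike.mem_coe, Submodule.mem_sInf]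
  intro N hN
  exact hN.1 hs

theorem isAlgebraIdeal_idealSpan (S : Set F) : IsAlgebraIdeal (idealSpan K S) := by
  intro x n hn
  simp only [idealSpan, Submodule.mem_sInf] at hn ⊢
  exact ⟨fun N hN => (hN.2 x n (hn N hN)).1, fun N hN => (hN.2 x n (hn N hN)).2⟩

theorem idealSpan_le {S : Set F} {N : Submodule K F} (hS : S ⊆ N) (hN : IsAlgebraIdeal N) :
    idealSpan K S ≤ N :=
  sInf_le ⟨hS, hN⟩

/-- The quotient of an algebra by the ideal generated by a set `S`. -/
def QuotientAlgebra (K : Type*) [Field K] {F : Type*} [NonUnitalNonAssocRing F] [Module K F]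
    (S : Set F) : Type _ :=
  F ⧸ idealSpan K S

namespace QuotientAlgebra

instance (S : Set F) : AddCommGroup (QuotientAlgebra K S) :=
  inferInstanceAs (AddCommGroup (F ⧸ idealSpan K S))

instance (S : Set F) : Module K (QuotientAlgebra K S) :=
  inferInstanceAs (Module K (F ⧸ idealSpan K S))

/-- The class of an element, as a linear map. -/
def mkₗ (S : Set F) : F →ₗ[K] QuotientAlgebra K S :=
  (idealSpan K S).mkQ

theorem mkₗ_surjective (S : Set F) : Function.Surjective (mkₗ (K := K) S) :=
  Submodule.mkQ_surjective _

theorem mkₗ_eq_iff (S : Set F) (x y : F) :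
    mkₗ (K := K) S x = mkₗ S y ↔ x - y ∈ idealSpan K S :=
  Submodule.Quotient.eq _

instance (S : Set F) : Mul (QuotientAlgebra K S) where
  mul := Quotient.map₂ (· * ·) (by
    intro a a' ha b b' hb
    have ha' := (Submodule.quotientRel_def _).1 ha
    have hb' := (Submodule.quotientRel_def _).1 hb
    refine (Submodule.quotientRel_def _).2 ?_
    have h : a * b - a' * b' = (a - a') * b + a' * (b - b') := by
      rw [sub_mul, mul_sub]; abel
    rw [h]
    exact add_mem (isAlgebraIdeal_idealSpan S _ _ ha').2 (isAlgebraIdeal_idealSpan S _ _ hb').1)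

theorem mkₗ_mul (S : Set F) (x y : F) :
    mkₗ (K := K) S (x * y) = mkₗ S x * mkₗ S y :=
  rfl

instance (S : Set F) : NonUnitalNonAssocRing (QuotientAlgebra K S) where
  left_distrib a b c := by
    obtain ⟨a, rfl⟩ := mkₗ_surjective S a
    obtain ⟨b, rfl⟩ := mkₗ_surjective S b
    obtain ⟨c, rfl⟩ := mkₗ_surjective S c
    simp only [← map_add, ← mkₗ_mul, mul_add]
  right_distrib a b c := by
    obtain ⟨a, rfl⟩ := mkₗ_surjective S a
    obtain ⟨b, rfl⟩ := mkₗ_surjective S b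
    obtain ⟨c, rfl⟩ := mkₗ_surjective S c
    simp only [← map_add, ← mkₗ_mul, add_mul]
  zero_mul a := by
    obtain ⟨a, rfl⟩ := mkₗ_surjective S a
    rw [← map_zero (mkₗ (K := K) S), ← mkₗ_mul, zero_mul]
  mul_zero a := by
    obtain ⟨a, rfl⟩ := mkₗ_surjective S a
    rw [← map_zero (mkₗ (K := K) S), ← mkₗ_mul, mul_zero]

instance (S : Set F) : IsScalarTower K (QuotientAlgebra K S) (QuotientAlgebra K S) where
  smul_assoc r a b := by
    obtain ⟨a, rfl⟩ := mkₗ_surjective S a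
    obtain ⟨b, rfl⟩ := mkₗ_surjective S b
    simp only [smul_eq_mul, ← map_smul, ← mkₗ_mul, smul_mul_assoc]

instance (S : Set F) : SMulCommClass K (QuotientAlgebra K S) (QuotientAlgebra K S) where
  smul_comm r a b := by
    obtain ⟨a, rfl⟩ := mkₗ_surjective S a
    obtain ⟨b, rfl⟩ := mkₗ_surjective S b
    simp only [smul_eq_mul, ← map_smul, ← mkₗ_mul, mul_smul_comm]

/-- The canonical projection onto the quotient, as an algebra morphism. -/
def mk (K : Type*) [Field K] {F : Type*} [NonUnitalNonAssocRing F] [Module K F]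
    [IsScalarTower K F F] [SMulCommClass K F F] (S : Set F) : F →ₙₐ[K] QuotientAlgebra K S where
  toFun := mkₗ S
  map_smul' r x := map_smul (mkₗ S) r x
  map_zero' := map_zero (mkₗ S)
  map_add' := map_add (mkₗ S)
  map_mul' := mkₗ_mul S

theorem mk_surjective (S : Set F) : Function.Surjective (mk K S) :=
  mkₗ_surjective S

theorem mk_eq_iff (S : Set F) (x y : F) : mk K S x = mk K S y ↔ x - y ∈ idealSpan K S :=
  mkₗ_eq_iff S x y

theorem mk_eq_of_mem {S : Set F} {x y : F} (h : x - y ∈ S) : mk K S x = mk K S y :=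
  (mk_eq_iff S x y).2 (subset_idealSpan S h)

variable {B : Type*} [NonUnitalNonAssocRing B] [Module K B] [IsScalarTower K B B]
  [SMulCommClass K B B]

theorem idealSpan_le_ker {S : Set F} (f : F →ₙₐ[K] B) (hf : ∀ s ∈ S, f s = 0) :
    idealSpan K S ≤ LinearMap.ker (f : F →ₗ[K] B) := by
  refine idealSpan_le (fun s hs => ?_) (fun x n hn => ?_)
  · exact hf s hs
  · have hn' : f n = 0 := hn
    constructor
    · change f (x * n) = 0
      rw [map_mul, hn', mul_zero]
    · change f (n * x) = 0
      rw [map_mul, hn', zero_mul]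

/-- An algebra morphism that kills `S` factors through the quotient. -/
def lift (S : Set F) (f : F →ₙₐ[K] B) (hf : ∀ s ∈ S, f s = 0) : QuotientAlgebra K S →ₙₐ[K] B :=
  let g : QuotientAlgebra K S →ₗ[K] B := (idealSpan K S).liftQ (f : F →ₗ[K] B)
    (idealSpan_le_ker f hf)
  { toFun := g
    map_smul' := fun r x => map_smul g r x
    map_zero' := map_zero g
    map_add' := map_add g
    map_mul' := fun a b => by
      obtain ⟨a, rfl⟩ := mkₗ_surjective S a
      obtain ⟨b, rfl⟩ := mkₗ_surjective S b
      exact map_mul f a b }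

@[simp]
theorem lift_mk (S : Set F) (f : F →ₙₐ[K] B) (hf : ∀ s ∈ S, f s = 0) (x : F) :
    lift S f hf (mk K S x) = f x :=
  rfl

end QuotientAlgebra

end Quotients

/-! ### Kernels -/

section Kernel

variable {K : Type*} [Field K] {A B : Type*} [NonUnitalNonAssocRing A] [Module K A]
  [IsScalarTower K A A] [SMulCommClass K A A] [NonUnitalNonAssocRing B] [Module K B]
  [IsScalarTower K B B] [SMulCommClass K B B]

/-- The kernel of an algebra morphism, a subalgebra of its domain. -/
def ker (f : A →ₙₐ[K] B) : NonUnitalSubalgebra K A where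
  carrier := {x | f x = 0}
  zero_mem' := map_zero f
  add_mem' {x y} hx hy := by
    change f (x + y) = 0
    rw [map_add, show f x = 0 from hx, show f y = 0 from hy, add_zero]
  mul_mem' {x y} hx hy := by
    change f (x * y) = 0
    rw [map_mul, show f x = 0 from hx, zero_mul]
  smul_mem' r x hx := by
    change f (r • x) = 0
    rw [map_smul, show f x = 0 from hx, smul_zero]

theorem mem_ker (f : A →ₙₐ[K] B) (x : A) : x ∈ ker f ↔ f x = 0 :=
  Iff.rfl

end Kernel

namespace VarietyAlgebra

variable {K : Type u} [Field K] {σ : Type w} {I : Set (FreeNonUnitalNonAssocAlgebra K σ)}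

/-! ### Coproducts in a variety -/

/-- The polynomials in the elements of `X` and `Y` that have to vanish in the coproduct of `X` and
`Y`: those expressing that the inclusions of `X` and of `Y` are linear and preserve products,
and all values of the polynomials in `I`. -/
inductive CoprodRelator (X Y : VarietyAlgebra.{u, v, w} I) :
    FreeNonUnitalNonAssocAlgebra K (X ⊕ Y) → Prop
  | inl_add (x x' : X) : CoprodRelator X Y
      (FreeNonUnitalNonAssocAlgebra.of K (Sum.inl (x + x')) -
        (FreeNonUnitalNonAssocAlgebra.of K (Sum.inl x) +
          FreeNonUnitalNonAssocAlgebra.of K (Sum.inl x')))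
  | inl_smul (r : K) (x : X) : CoprodRelator X Y
      (FreeNonUnitalNonAssocAlgebra.of K (Sum.inl (r • x)) -
        r • FreeNonUnitalNonAssocAlgebra.of K (Sum.inl x))
  | inl_mul (x x' : X) : CoprodRelator X Y
      (FreeNonUnitalNonAssocAlgebra.of K (Sum.inl (x * x')) -
        FreeNonUnitalNonAssocAlgebra.of K (Sum.inl x) *
          FreeNonUnitalNonAssocAlgebra.of K (Sum.inl x'))
  | inr_add (y y' : Y) : CoprodRelator X Y
      (FreeNonUnitalNonAssocAlgebra.of K (Sum.inr (y + y')) -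
        (FreeNonUnitalNonAssocAlgebra.of K (Sum.inr y) +
          FreeNonUnitalNonAssocAlgebra.of K (Sum.inr y')))
  | inr_smul (r : K) (y : Y) : CoprodRelator X Y
      (FreeNonUnitalNonAssocAlgebra.of K (Sum.inr (r • y)) -
        r • FreeNonUnitalNonAssocAlgebra.of K (Sum.inr y))
  | inr_mul (y y' : Y) : CoprodRelator X Y
      (FreeNonUnitalNonAssocAlgebra.of K (Sum.inr (y * y')) -
        FreeNonUnitalNonAssocAlgebra.of K (Sum.inr y) *
          FreeNonUnitalNonAssocAlgebra.of K (Sum.inr y'))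
  | identity (φ : FreeNonUnitalNonAssocAlgebra K σ) (hφ : φ ∈ I)
      (a : σ → FreeNonUnitalNonAssocAlgebra K (X ⊕ Y)) : CoprodRelator X Y
      (FreeNonUnitalNonAssocAlgebra.lift K a φ)

/-- The coproduct `X + Y` in the variety: polynomials with variables in `X` and `Y`, modulo the
relations of `X`, those of `Y`, and the identities of the variety. -/
noncomputable def coprod (X Y : VarietyAlgebra.{u, v, w} I) : VarietyAlgebra.{u, v, w} I where
  carrier := QuotientAlgebra K {p | CoprodRelator X Y p}
  isIdentity φ hφ a := by
    choose b hb using fun i => QuotientAlgebra.mk_surjective _ (a i)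
    obtain rfl : (fun i => QuotientAlgebra.mk K _ (b i)) = a := funext hb
    rw [← comp_lift, ← map_zero (QuotientAlgebra.mk K {p | CoprodRelator X Y p})]
    apply QuotientAlgebra.mk_eq_of_mem
    rw [sub_zero]
    exact CoprodRelator.identity φ hφ b

/-- The canonical projection from polynomials in the elements of `X` and `Y` to `X + Y`. -/
noncomputable def coprodMk (X Y : VarietyAlgebra.{u, v, w} I) :
    FreeNonUnitalNonAssocAlgebra K (X ⊕ Y) →ₙₐ[K] coprod X Y :=
  QuotientAlgebra.mk K {p | CoprodRelator X Y p}

/-- The coproduct inclusion `ι_X : X → X + Y`. -/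
noncomputable def inl (X Y : VarietyAlgebra.{u, v, w} I) : X →ₙₐ[K] coprod X Y where
  toFun x := coprodMk X Y (FreeNonUnitalNonAssocAlgebra.of K (Sum.inl x))
  map_smul' r x := by
    change _ = r • _
    rw [← map_smul]
    exact QuotientAlgebra.mk_eq_of_mem (CoprodRelator.inl_smul r x)
  map_zero' := by
    rw [← zero_smul K (0 : X), ← zero_smul K (coprodMk X Y _), ← map_smul]
    exact QuotientAlgebra.mk_eq_of_mem (CoprodRelator.inl_smul 0 0)
  map_add' x x' := by
    rw [← map_add]
    exact QuotientAlgebra.mk_eq_of_mem (CoprodRelator.inl_add x x')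
  map_mul' x x' := by
    rw [← map_mul]
    exact QuotientAlgebra.mk_eq_of_mem (CoprodRelator.inl_mul x x')

/-- The coproduct inclusion `ι_Y : Y → X + Y`. -/
noncomputable def inr (X Y : VarietyAlgebra.{u, v, w} I) : Y →ₙₐ[K] coprod X Y where
  toFun y := coprodMk X Y (FreeNonUnitalNonAssocAlgebra.of K (Sum.inr y))
  map_smul' r y := by
    change _ = r • _
    rw [← map_smul]
    exact QuotientAlgebra.mk_eq_of_mem (CoprodRelator.inr_smul r y)
  map_zero' := by
    rw [← zero_smul K (0 : Y), ← zero_smul K (coprodMk X Y _), ← map_smul]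
    exact QuotientAlgebra.mk_eq_of_mem (CoprodRelator.inr_smul 0 0)
  map_add' y y' := by
    rw [← map_add]
    exact QuotientAlgebra.mk_eq_of_mem (CoprodRelator.inr_add y y')
  map_mul' y y' := by
    rw [← map_mul]
    exact QuotientAlgebra.mk_eq_of_mem (CoprodRelator.inr_mul y y')

/-- A morphism out of `X + Y` is determined by its restrictions to `X` and to `Y`. -/
theorem coprod_hom_ext {X Y : VarietyAlgebra.{u, v, w} I} {B : Type*} [NonUnitalNonAssocRing B]
    [Module K B] [IsScalarTower K B B] [SMulCommClass K B B] {f g : coprod X Y →ₙₐ[K] B}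
    (hl : ∀ x, f (inl X Y x) = g (inl X Y x)) (hr : ∀ y, f (inr X Y y) = g (inr X Y y)) :
    f = g := by
  have h : f.comp (coprodMk X Y) = g.comp (coprodMk X Y) := by
    apply FreeNonUnitalNonAssocAlgebra.hom_ext
    rintro (x | y)
    · exact hl x
    · exact hr y
  ext z
  obtain ⟨p, rfl⟩ := QuotientAlgebra.mk_surjective _ z
  exact DFunLike.congr_fun h p

/-- The morphism `⟨f, g⟩ : X + Y → B` induced by morphisms `f : X → B` and `g : Y → B`. -/
noncomputable def desc {X Y B : VarietyAlgebra.{u, v, w} I} (f : X →ₙₐ[K] B) (g : Y →ₙₐ[K] B) :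
    coprod X Y →ₙₐ[K] B :=
  QuotientAlgebra.lift _ (FreeNonUnitalNonAssocAlgebra.lift K (Sum.elim f g)) (by
    rintro _ (⟨x, x'⟩ | ⟨r, x⟩ | ⟨x, x'⟩ | ⟨y, y'⟩ | ⟨r, y⟩ | ⟨y, y'⟩ | ⟨φ, hφ, a⟩)
    · simp [map_sub]
    · simp [map_sub]
    · simp [map_sub]
    · simp [map_sub]
    · simp [map_sub]
    · simp [map_sub]
    · rw [comp_lift]
      exact B.isIdentity φ hφ _)

@[simp]
theorem desc_inl {X Y B : VarietyAlgebra.{u, v, w} I} (f : X →ₙₐ[K] B) (g : Y →ₙₐ[K] B) (x : X) :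
    desc f g (inl X Y x) = f x :=
  FreeNonUnitalNonAssocAlgebra.lift_of_apply K (Sum.elim f g) (Sum.inl x)

@[simp]
theorem desc_inr {X Y B : VarietyAlgebra.{u, v, w} I} (f : X →ₙₐ[K] B) (g : Y →ₙₐ[K] B) (y : Y) :
    desc f g (inr X Y y) = g y :=
  FreeNonUnitalNonAssocAlgebra.lift_of_apply K (Sum.elim f g) (Sum.inr y)

/-- The morphism `f + g : X + Y → X' + Y'`. -/
noncomputable def coprodMap {X X' Y Y' : VarietyAlgebra.{u, v, w} I} (f : X →ₙₐ[K] X') (g : Y →ₙₐ[K] Y') :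
    coprod X Y →ₙₐ[K] coprod X' Y' :=
  desc ((inl X' Y').comp f) ((inr X' Y').comp g)

/-! ### Products and subobjects in a variety -/

/-- The product `X × Y`, with the pointwise operations. -/
noncomputable def prod (X Y : VarietyAlgebra.{u, v, w} I) : VarietyAlgebra.{u, v, w} I where
  carrier := X × Y
  isIdentity φ hφ a := by
    apply Prod.ext
    · change NonUnitalAlgHom.fst K X Y _ = 0
      rw [comp_lift]
      exact X.isIdentity φ hφ _
    · change NonUnitalAlgHom.snd K X Y _ = 0
      rw [comp_lift]
      exact Y.isIdentity φ hφ _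

/-- The morphism `(f, g) : A → X × Y` induced by morphisms `f : A → X` and `g : A → Y`. -/
noncomputable def pair {A X Y : VarietyAlgebra.{u, v, w} I} (f : A →ₙₐ[K] X) (g : A →ₙₐ[K] Y) :
    A →ₙₐ[K] prod X Y :=
  NonUnitalAlgHom.prod f g

@[simp]
theorem pair_apply {A X Y : VarietyAlgebra.{u, v, w} I} (f : A →ₙₐ[K] X) (g : A →ₙₐ[K] Y)
    (a : A) : pair f g a = (f a, g a) :=
  rfl

/-- A subalgebra of an algebra of the variety, as an algebra of the variety. -/
noncomputable def ofSubalgebra (X : VarietyAlgebra.{u, v, w} I) (S : NonUnitalSubalgebra K X) :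
    VarietyAlgebra.{u, v, w} I where
  carrier := S
  isIdentity φ hφ a := by
    apply Subtype.ext
    change NonUnitalSubalgebraClass.subtype S _ = 0
    rw [comp_lift]
    exact X.isIdentity φ hφ _

/-! ### Cosmash products -/

/-- The canonical morphism `Σ_{X,Y} : X + Y → X × Y`. -/
noncomputable def sigma₂ (X Y : VarietyAlgebra.{u, v, w} I) : coprod X Y →ₙₐ[K] prod X Y :=
  pair (desc (NonUnitalAlgHom.id K X) 0) (desc 0 (NonUnitalAlgHom.id K Y))

/-- The binary cosmash product `X ◇ Y`, the kernel of `Σ_{X,Y}`. -/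
noncomputable def cosmash₂ (X Y : VarietyAlgebra.{u, v, w} I) : VarietyAlgebra.{u, v, w} I :=
  ofSubalgebra (coprod X Y) (ker (sigma₂ X Y))

/-- The inclusion `ι_{X,Y} : X ◇ Y → X + Y`. -/
noncomputable def cosmash₂Incl (X Y : VarietyAlgebra.{u, v, w} I) : cosmash₂ X Y →ₙₐ[K] coprod X Y :=
  NonUnitalSubalgebraClass.subtype (ker (sigma₂ X Y))

/-- The canonical morphism `Σ_{X,Y,Z} : X + (Y + Z) → (X + Y) × ((X + Z) × (Y + Z))`, with
components `⟨ι_X, ι_Y, 0⟩`, `⟨ι_X, 0, ι_Z⟩` and `⟨0, ι_Y, ι_Z⟩`. -/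
noncomputable def sigma₃ (X Y Z : VarietyAlgebra.{u, v, w} I) :
    coprod X (coprod Y Z) →ₙₐ[K] prod (coprod X Y) (prod (coprod X Z) (coprod Y Z)) :=
  pair (desc (inl X Y) (desc (inr X Y) 0))
    (pair (desc (inl X Z) (desc 0 (inr X Z))) (desc 0 (desc (inl Y Z) (inr Y Z))))

/-- The ternary cosmash product `X ◇ Y ◇ Z`, the kernel of `Σ_{X,Y,Z}`. -/
noncomputable def cosmash₃ (X Y Z : VarietyAlgebra.{u, v, w} I) : VarietyAlgebra.{u, v, w} I :=
  ofSubalgebra (coprod X (coprod Y Z)) (ker (sigma₃ X Y Z))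

/-- The inclusion `ι_{X,Y,Z} : X ◇ Y ◇ Z → X + (Y + Z)`. -/
noncomputable def cosmash₃Incl (X Y Z : VarietyAlgebra.{u, v, w} I) :
    cosmash₃ X Y Z →ₙₐ[K] coprod X (coprod Y Z) :=
  NonUnitalSubalgebraClass.subtype (ker (sigma₃ X Y Z))

theorem sigma₂_cosmash₂Incl (X Y : VarietyAlgebra.{u, v, w} I) (c : cosmash₂ X Y) :
    sigma₂ X Y (cosmash₂Incl X Y c) = 0 :=
  c.2

theorem desc_id_zero_cosmash₂Incl (X Y : VarietyAlgebra.{u, v, w} I) (c : cosmash₂ X Y) :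
    desc (NonUnitalAlgHom.id K X) 0 (cosmash₂Incl X Y c) = 0 :=
  congrArg Prod.fst (sigma₂_cosmash₂Incl X Y c)

theorem desc_zero_id_cosmash₂Incl (X Y : VarietyAlgebra.{u, v, w} I) (c : cosmash₂ X Y) :
    desc 0 (NonUnitalAlgHom.id K Y) (cosmash₂Incl X Y c) = 0 :=
  congrArg Prod.snd (sigma₂_cosmash₂Incl X Y c)

/-- The right-hand vertical morphism
`(ι_X, ι_X) × ι_{Y,Z} : X × (Y ◇ Z) → (X + Y) × ((X + Z) × (Y + Z))`. -/
noncomputable def comparisonCodomainMap (X Y Z : VarietyAlgebra.{u, v, w} I) :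
    prod X (cosmash₂ Y Z) →ₙₐ[K] prod (coprod X Y) (prod (coprod X Z) (coprod Y Z)) :=
  pair ((inl X Y).comp (NonUnitalAlgHom.fst K X (cosmash₂ Y Z)))
    (pair ((inl X Z).comp (NonUnitalAlgHom.fst K X (cosmash₂ Y Z)))
      ((cosmash₂Incl Y Z).comp (NonUnitalAlgHom.snd K X (cosmash₂ Y Z))))

/-- The square defining the comparison map commutes. -/
theorem sigma₃_comp_coprodMap (X Y Z : VarietyAlgebra.{u, v, w} I) :
    (sigma₃ X Y Z).comp (coprodMap (NonUnitalAlgHom.id K X) (cosmash₂Incl Y Z)) =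
      (comparisonCodomainMap X Y Z).comp (sigma₂ X (cosmash₂ Y Z)) := by
  apply coprod_hom_ext
  · intro x
    simp only [NonUnitalAlgHom.comp_apply, sigma₃, sigma₂, coprodMap, pair_apply, desc_inl,
      NonUnitalAlgHom.coe_id, id_eq, NonUnitalAlgHom.zero_apply]
    exact Prod.ext rfl (Prod.ext rfl (map_zero (cosmash₂Incl Y Z)).symm)
  · intro c
    have h₁ : (desc (inr X Y) 0 : coprod Y Z →ₙₐ[K] coprod X Y) =
        (inr X Y).comp (desc (NonUnitalAlgHom.id K Y) 0) := by
      apply coprod_hom_ext <;> intro y <;> simp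
    have h₂ : (desc 0 (inr X Z) : coprod Y Z →ₙₐ[K] coprod X Z) =
        (inr X Z).comp (desc 0 (NonUnitalAlgHom.id K Z)) := by
      apply coprod_hom_ext <;> intro y <;> simp
    have h₃ : (desc (inl Y Z) (inr Y Z) : coprod Y Z →ₙₐ[K] coprod Y Z) =
        NonUnitalAlgHom.id K _ := by
      apply coprod_hom_ext <;> intro y <;> simp
    simp only [NonUnitalAlgHom.comp_apply, sigma₃, sigma₂, coprodMap, pair_apply, desc_inr,
      NonUnitalAlgHom.coe_id, id_eq, NonUnitalAlgHom.zero_apply, h₁, h₂, h₃,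
      desc_id_zero_cosmash₂Incl, desc_zero_id_cosmash₂Incl]
    exact Prod.ext ((map_zero (inr X Y)).trans (map_zero (inl X Y)).symm)
      (Prod.ext ((map_zero (inr X Z)).trans (map_zero (inl X Z)).symm) rfl)

/-- The comparison map `Φ_{X,Y,Z} : X ◇ (Y ◇ Z) → X ◇ Y ◇ Z`, the restriction of
`1_X + ι_{Y,Z} : X + (Y ◇ Z) → X + (Y + Z)` to the kernels of `Σ_{X,Y◇Z}` and `Σ_{X,Y,Z}`. -/
noncomputable def comparison (X Y Z : VarietyAlgebra.{u, v, w} I) :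
    cosmash₂ X (cosmash₂ Y Z) →ₙₐ[K] cosmash₃ X Y Z :=
  NonUnitalAlgHom.codRestrict
    ((coprodMap (NonUnitalAlgHom.id K X) (cosmash₂Incl Y Z)).comp
      (cosmash₂Incl X (cosmash₂ Y Z)))
    (ker (sigma₃ X Y Z)) (fun c => by
      have h := DFunLike.congr_fun (sigma₃_comp_coprodMap X Y Z) (cosmash₂Incl X (cosmash₂ Y Z) c)
      rw [mem_ker]
      refine h.trans ?_
      rw [NonUnitalAlgHom.comp_apply, sigma₂_cosmash₂Incl, map_zero])

end VarietyAlgebra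

end Cosmash

set_option linter.unusedSectionVars false

/-! Sufficiency. The four identities say that products with `x` inside the parentheses are
combinations of those with `x` outside; only the resulting membership statement `PullsOut` is
needed, in `X + (Y + Z)`. Let `N` be the closure of `Y ◇ Z` under multiplication by `X`. Pulling out
shows that the elements multiplying `N` into itself form a subalgebra. It contains `X` by
construction, and `Y + Z` because `Y ◇ Z` is an ideal there, so `N` is an ideal. Modulo `N` the
images of `Y` and `Z` annihilate each other, hence so do the ideals they generate, again by pulling
out. It follows that every `t` is congruent modulo `N` to its part without `Z`, plus its part
without `Y`, minus its part in `X` alone (`sub_keep_mem_mixedSpan`). On the ternary cosmash product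
these parts vanish, so `t` lies in `N`, which is contained in the image of `X + (Y ◇ Z)`.

Necessity. For `A` in the variety, adjoin commuting `ε₀, ε₁, ε₂` of square zero and keep the terms
of positive degree. Homogeneity keeps this polarization in the variety over any field: since `εᵢ² =
0`, the coefficients of a value of an identity are values or full polarizations of that identity,
that is, signed sums of its values on `A`. Map the lines through `ε₀x`, `ε₁y`, `ε₂z` into it. The
product `(xy)z` of the generators lies in the ternary cosmash product, so by surjectivity it comes
from `X + (Y ◇ Z)`. Elements of `Y ◇ Z` retain only an `ε₁ε₂` term, a combination of `yz` and `zy`;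
the `ε₀ε₁ε₂` coefficient is therefore a combination of products with `x` outside. Taking `A` free on
three generators makes the coefficients uniform. -/

namespace Cosmash

/-! ### Multipliers and ideals when an element can be pulled out of parentheses -/

section PullingOut

variable {K : Type*} [Field K] {C : Type*} [NonUnitalNonAssocRing C] [Module K C]
  [IsScalarTower K C C] [SMulCommClass K C C]

/-- Every product of `x`, `y`, `z` in which `x` stands inside the parentheses lies in all
subspaces that contain the products in which `x` stands outside. -/
def PullsOut (K : Type*) [Field K] (C : Type*) [NonUnitalNonAssocRing C] [Module K C] : Prop :=
  ∀ (N : Submodule K C) (x y z : C), x * (y * z) ∈ N → x * (z * y) ∈ N → (y * z) * x ∈ N →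
    (z * y) * x ∈ N →
    (x * y) * z ∈ N ∧ (y * x) * z ∈ N ∧ z * (x * y) ∈ N ∧ z * (y * x) ∈ N

/-- The elements that multiply all elements of `W` into `N`, on both sides. -/
def multipliers (W : Set C) (N : Submodule K C) : Submodule K C where
  carrier := {c | ∀ a ∈ W, a * c ∈ N ∧ c * a ∈ N}
  zero_mem' a _ := by simp
  add_mem' hx hy a ha := by
    rw [mul_add, add_mul]
    exact ⟨add_mem (hx a ha).1 (hy a ha).1, add_mem (hx a ha).2 (hy a ha).2⟩
  smul_mem' r c hc a ha := by
    rw [mul_smul_comm, smul_mul_assoc]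
    exact ⟨N.smul_mem r (hc a ha).1, N.smul_mem r (hc a ha).2⟩

/-- For `c` a multiplier and `a ∈ W`, pulling `x` out of a product of `a` with `xc` or `cx` leaves
`x` times `ac` or `ca`, which the ideal `N` absorbs. -/
theorem PullsOut.isAlgebraIdeal_multipliers (h : PullsOut K C) {N : Submodule K C}
    (hN : IsAlgebraIdeal N) (W : Set C) : IsAlgebraIdeal (multipliers W N) := by
  intro x c hc
  have key : ∀ a ∈ W, _ := fun a ha =>
    h N x c a (hN x _ (hc a ha).2).1 (hN x _ (hc a ha).1).1 (hN x _ (hc a ha).2).2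
      (hN x _ (hc a ha).1).2
  exact ⟨fun a ha => ⟨(key a ha).2.2.1, (key a ha).1⟩,
    fun a ha => ⟨(key a ha).2.2.2, (key a ha).2.1⟩⟩

theorem PullsOut.mul_mem_multipliers_self (h : PullsOut K C) {N : Submodule K C} {c d : C}
    (hc : c ∈ multipliers (N : Set C) N) (hd : d ∈ multipliers (N : Set C) N) :
    c * d ∈ multipliers (N : Set C) N := by
  intro n hn
  have key := h N c d n (hc _ (hd n hn).2).2 (hc _ (hd n hn).1).2 (hc _ (hd n hn).2).1
    (hc _ (hd n hn).1).1
  exact ⟨key.2.2.1, key.1⟩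

/-- The multipliers of a subspace into itself form a subalgebra. -/
def PullsOut.idealizer (h : PullsOut K C) (N : Submodule K C) : NonUnitalSubalgebra K C where
  __ := multipliers (N : Set C) N
  mul_mem' := h.mul_mem_multipliers_self

/-- The smallest subspace that contains `P` and is stable under multiplication by elements
of `X`. -/
def stableSpan (K : Type*) [Field K] {C : Type*} [NonUnitalNonAssocRing C] [Module K C]
    (X P : Set C) : Submodule K C :=
  sInf {N : Submodule K C | P ⊆ N ∧ ∀ x ∈ X, ∀ n ∈ N, x * n ∈ N ∧ n * x ∈ N}

theorem subset_stableSpan (X P : Set C) : P ⊆ stableSpan K X P := by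
  intro p hp
  simp only [stableSpan, SetLike.mem_coe, Submodule.mem_sInf]
  exact fun N hN => hN.1 hp

theorem stableSpan_stable {X P : Set C} {x n : C} (hx : x ∈ X) (hn : n ∈ stableSpan K X P) :
    x * n ∈ stableSpan K X P ∧ n * x ∈ stableSpan K X P := by
  simp only [stableSpan, Submodule.mem_sInf] at hn ⊢
  exact ⟨fun N hN => (hN.2 x hx n (hn N hN)).1, fun N hN => (hN.2 x hx n (hn N hN)).2⟩

theorem stableSpan_le {X P : Set C} {N : Submodule K C} (hP : P ⊆ N)
    (hX : ∀ x ∈ X, ∀ n ∈ N, x * n ∈ N ∧ n * x ∈ N) : stableSpan K X P ≤ N :=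
  sInf_le ⟨hP, hX⟩

/-- If `x` can be pulled out of parentheses, then multiplication by a set that stabilises `P`
stabilises the subspace generated by `P` under multiplication by `X`. -/
theorem PullsOut.stableSpan_le_multipliers (h : PullsOut K C) {X P W : Set C}
    (hW : ∀ a ∈ W, ∀ p ∈ P, a * p ∈ P ∧ p * a ∈ P) :
    stableSpan K X P ≤ stableSpan K X P ⊓ multipliers W (stableSpan K X P) := by
  refine stableSpan_le (fun p hp => ⟨subset_stableSpan X P hp, fun a ha =>
    ⟨subset_stableSpan X P (hW a ha p hp).1, subset_stableSpan X P (hW a ha p hp).2⟩⟩) ?_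
  rintro x hx n ⟨hn, hnW⟩
  have key : ∀ a ∈ W, _ := fun a ha =>
    h _ x n a (stableSpan_stable hx (hnW a ha).2).1 (stableSpan_stable hx (hnW a ha).1).1
      (stableSpan_stable hx (hnW a ha).2).2 (stableSpan_stable hx (hnW a ha).1).2
  exact ⟨⟨(stableSpan_stable hx hn).1, fun a ha => ⟨(key a ha).2.2.1, (key a ha).1⟩⟩,
    ⟨(stableSpan_stable hx hn).2, fun a ha => ⟨(key a ha).2.2.2, (key a ha).2.1⟩⟩⟩

/-- If the annihilator of `V` modulo the ideal `N` contains `W`, then the ideals generated by `V`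
and by `W` annihilate each other modulo `N`. -/
theorem PullsOut.idealSpan_mul_mem (h : PullsOut K C) {N : Submodule K C} (hN : IsAlgebraIdeal N)
    {V W : Set C} (hVW : ∀ a ∈ V, ∀ b ∈ W, a * b ∈ N ∧ b * a ∈ N) {a b : C}
    (ha : a ∈ idealSpan K V) (hb : b ∈ idealSpan K W) : a * b ∈ N ∧ b * a ∈ N := by
  have h₁ : idealSpan K W ≤ multipliers V N :=
    idealSpan_le (fun b hb a ha => hVW a ha b hb) (h.isAlgebraIdeal_multipliers hN V)
  have h₂ : idealSpan K V ≤ multipliers (idealSpan K W : Set C) N :=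
    idealSpan_le (fun a ha b hb => (h₁ hb a ha).symm) (h.isAlgebraIdeal_multipliers hN _)
  exact (h₂ ha b hb).symm

end PullingOut

/-! ### Generation of coproducts -/

namespace VarietyAlgebra

variable {K : Type u} [Field K] {σ : Type w} {I : Set (FreeNonUnitalNonAssocAlgebra K σ)}

/-- The coproduct is generated by the images of the two inclusions. -/
theorem mem_of_coprod {X Y : VarietyAlgebra.{u, v, w} I} (S : NonUnitalSubalgebra K (coprod X Y))
    (hl : ∀ x, inl X Y x ∈ S) (hr : ∀ y, inr X Y y ∈ S) (t : coprod X Y) : t ∈ S := by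
  -- Both inclusions corestrict to `S`, which is again in the variety; the induced map followed by
  -- the inclusion of `S` is the identity by uniqueness.
  let f : coprod X Y →ₙₐ[K] ofSubalgebra (coprod X Y) S :=
    desc (NonUnitalAlgHom.codRestrict (inl X Y) S hl) (NonUnitalAlgHom.codRestrict (inr X Y) S hr)
  have h : (NonUnitalSubalgebraClass.subtype S).comp f = NonUnitalAlgHom.id K (coprod X Y) := by
    apply coprod_hom_ext
    · intro x
      exact congrArg Subtype.val (desc_inl (B := ofSubalgebra (coprod X Y) S) _ _ x)
    · intro y
      exact congrArg Subtype.val (desc_inr (B := ofSubalgebra (coprod X Y) S) _ _ y)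
  have ht : (NonUnitalSubalgebraClass.subtype S) (f t) = t := DFunLike.congr_fun h t
  rw [← ht]
  exact (f t).2

@[elab_as_elim]
theorem coprod_induction {X Y : VarietyAlgebra.{u, v, w} I} {p : coprod X Y → Prop}
    (hX : ∀ x, p (inl X Y x)) (hY : ∀ y, p (inr X Y y))
    (add : ∀ a b, p a → p b → p (a + b)) (smul : ∀ (r : K) a, p a → p (r • a))
    (mul : ∀ a b, p a → p b → p (a * b)) (t : coprod X Y) : p t :=
  mem_of_coprod
    { carrier := {t | p t}
      zero_mem' := by
        have := hX 0
        rwa [map_zero] at this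
      add_mem' := fun {a b} => add a b
      smul_mem' := smul
      mul_mem' := fun {a b} => mul a b } hX hY t

@[elab_as_elim]
theorem coprod₃_induction {X Y Z : VarietyAlgebra.{u, v, w} I}
    {p : coprod X (coprod Y Z) → Prop}
    (hX : ∀ x, p (inl X (coprod Y Z) x))
    (hY : ∀ y, p (inr X (coprod Y Z) (inl Y Z y)))
    (hZ : ∀ z, p (inr X (coprod Y Z) (inr Y Z z)))
    (add : ∀ a b, p a → p b → p (a + b)) (smul : ∀ (r : K) a, p a → p (r • a))
    (mul : ∀ a b, p a → p b → p (a * b)) (t : coprod X (coprod Y Z)) : p t := by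
  refine coprod_induction (t := t) hX (fun q => ?_) add smul mul
  refine coprod_induction (t := q) hY hZ (fun a b ha hb => ?_) (fun r a ha => ?_)
    (fun a b ha hb => ?_)
  · rw [map_add]
    exact add _ _ ha hb
  · rw [map_smul]
    exact smul r _ ha
  · rw [map_mul]
    exact mul _ _ ha hb

/-! ### Sufficiency: surjectivity of the comparison map -/

section Surjectivity

variable (X Y Z : VarietyAlgebra.{u, v, w} I)

/-- The endomorphism of `X + (Y + Z)` that kills `Y` and `Z`. -/
noncomputable def keepX : coprod X (coprod Y Z) →ₙₐ[K] coprod X (coprod Y Z) :=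
  desc (inl X (coprod Y Z)) 0

/-- The endomorphism of `X + (Y + Z)` that kills `Z`. -/
noncomputable def keepXY : coprod X (coprod Y Z) →ₙₐ[K] coprod X (coprod Y Z) :=
  desc (inl X (coprod Y Z)) (desc ((inr X (coprod Y Z)).comp (inl Y Z)) 0)

/-- The endomorphism of `X + (Y + Z)` that kills `Y`. -/
noncomputable def keepXZ : coprod X (coprod Y Z) →ₙₐ[K] coprod X (coprod Y Z) :=
  desc (inl X (coprod Y Z)) (desc 0 ((inr X (coprod Y Z)).comp (inr Y Z)))

/-- The image of `Y` in `X + (Y + Z)`. -/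
def imageY : Set (coprod X (coprod Y Z)) := Set.range fun y => inr X (coprod Y Z) (inl Y Z y)

/-- The image of `Z` in `X + (Y + Z)`. -/
def imageZ : Set (coprod X (coprod Y Z)) := Set.range fun z => inr X (coprod Y Z) (inr Y Z z)

/-- The image of `Y ◇ Z` in `X + (Y + Z)`. -/
def imageCosmash : Set (coprod X (coprod Y Z)) :=
  Set.range fun c => inr X (coprod Y Z) (cosmash₂Incl Y Z c)

/-- The subspace of `X + (Y + Z)` generated by `Y ◇ Z` under multiplication by `X`. -/
noncomputable def mixedSpan : Submodule K (coprod X (coprod Y Z)) :=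
  stableSpan K (Set.range (inl X (coprod Y Z))) (imageCosmash X Y Z)

variable {X Y Z}

theorem inr_mem_imageCosmash {p : coprod Y Z} (hp : sigma₂ Y Z p = 0) :
    inr X (coprod Y Z) p ∈ imageCosmash X Y Z :=
  ⟨⟨p, hp⟩, rfl⟩

/-- The idealizer is a subalgebra, so it suffices that it contains the generators: `X` by definition
of the span, and `Y + Z` because `Y ◇ Z` is a kernel, hence an ideal, in `Y + Z`. -/
theorem isAlgebraIdeal_mixedSpan (h : PullsOut K (coprod X (coprod Y Z))) :
    IsAlgebraIdeal (mixedSpan X Y Z) := by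
  have hS : ∀ t, t ∈ h.idealizer (mixedSpan X Y Z) := by
    refine mem_of_coprod _ ?_ ?_
    · exact fun x n hn => (stableSpan_stable (Set.mem_range_self x) hn).symm
    · have hW := h.stableSpan_le_multipliers (X := Set.range (inl X (coprod Y Z)))
        (P := imageCosmash X Y Z) (W := Set.range (inr X (coprod Y Z))) (by
          rintro _ ⟨q, rfl⟩ _ ⟨c, rfl⟩
          constructor
          · change inr X (coprod Y Z) q * inr X (coprod Y Z) (cosmash₂Incl Y Z c) ∈ _
            rw [← map_mul]
            apply inr_mem_imageCosmash
            rw [map_mul, sigma₂_cosmash₂Incl, mul_zero]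
          · change inr X (coprod Y Z) (cosmash₂Incl Y Z c) * inr X (coprod Y Z) q ∈ _
            rw [← map_mul]
            apply inr_mem_imageCosmash
            rw [map_mul, sigma₂_cosmash₂Incl, zero_mul])
      exact fun q n hn => ((hW hn).2 _ (Set.mem_range_self q)).symm
  exact fun x n hn => (hS x n hn).symm

/-- Both maps are morphisms and agree on generators modulo the ideal of `Y`; congruence passes to
products by `f(ab) - g(ab) = (fa - ga)fb + ga(fb - gb)`. -/
theorem keepXY_sub_keepX_mem (t : coprod X (coprod Y Z)) :
    keepXY X Y Z t - keepX X Y Z t ∈ idealSpan K (imageY X Y Z) := by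
  refine coprod₃_induction (t := t) ?_ ?_ ?_ ?_ ?_ ?_
  · intro x
    simp [keepXY, keepX]
  · intro y
    simp only [keepXY, keepX, desc_inr, desc_inl, NonUnitalAlgHom.zero_apply, sub_zero,
      NonUnitalAlgHom.comp_apply]
    exact subset_idealSpan _ ⟨y, rfl⟩
  · intro z
    simp [keepXY, keepX]
  · intro a b ha hb
    rw [map_add, map_add, add_sub_add_comm]
    exact add_mem ha hb
  · intro r a ha
    rw [map_smul, map_smul, ← smul_sub]
    exact Submodule.smul_mem _ r ha
  · intro a b ha hb
    have e : keepXY X Y Z (a * b) - keepX X Y Z (a * b) =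
        (keepXY X Y Z a - keepX X Y Z a) * keepXY X Y Z b +
          keepX X Y Z a * (keepXY X Y Z b - keepX X Y Z b) := by
      rw [map_mul, map_mul, sub_mul, mul_sub]; abel
    rw [e]
    exact add_mem (isAlgebraIdeal_idealSpan _ _ _ ha).2 (isAlgebraIdeal_idealSpan _ _ _ hb).1

theorem keepXZ_sub_keepX_mem (t : coprod X (coprod Y Z)) :
    keepXZ X Y Z t - keepX X Y Z t ∈ idealSpan K (imageZ X Y Z) := by
  refine coprod₃_induction (t := t) ?_ ?_ ?_ ?_ ?_ ?_
  · intro x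
    simp [keepXZ, keepX]
  · intro y
    simp [keepXZ, keepX]
  · intro z
    simp only [keepXZ, keepX, desc_inr, NonUnitalAlgHom.zero_apply, sub_zero,
      NonUnitalAlgHom.comp_apply]
    exact subset_idealSpan _ ⟨z, rfl⟩
  · intro a b ha hb
    rw [map_add, map_add, add_sub_add_comm]
    exact add_mem ha hb
  · intro r a ha
    rw [map_smul, map_smul, ← smul_sub]
    exact Submodule.smul_mem _ r ha
  · intro a b ha hb
    have e : keepXZ X Y Z (a * b) - keepX X Y Z (a * b) =
        (keepXZ X Y Z a - keepX X Y Z a) * keepXZ X Y Z b +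
          keepX X Y Z a * (keepXZ X Y Z b - keepX X Y Z b) := by
      rw [map_mul, map_mul, sub_mul, mul_sub]; abel
    rw [e]
    exact add_mem (isAlgebraIdeal_idealSpan _ _ _ ha).2 (isAlgebraIdeal_idealSpan _ _ _ hb).1

/-- Each component of `Σ_{Y,Z}` kills one factor of `yz` and of `zy`, so both products already lie
in `Y ◇ Z`. -/
theorem imageY_mul_imageZ_mem : ∀ a ∈ imageY X Y Z, ∀ b ∈ imageZ X Y Z,
    a * b ∈ mixedSpan X Y Z ∧ b * a ∈ mixedSpan X Y Z := by
  rintro _ ⟨y, rfl⟩ _ ⟨z, rfl⟩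
  constructor
  · change inr X (coprod Y Z) (inl Y Z y) * inr X (coprod Y Z) (inr Y Z z) ∈ _
    rw [← map_mul]
    refine subset_stableSpan _ _ (inr_mem_imageCosmash ?_)
    rw [map_mul, sigma₂, pair_apply, pair_apply]
    simp only [desc_inl, desc_inr, NonUnitalAlgHom.zero_apply]
    exact Prod.ext (mul_zero _) (zero_mul _)
  · change inr X (coprod Y Z) (inr Y Z z) * inr X (coprod Y Z) (inl Y Z y) ∈ _
    rw [← map_mul]
    refine subset_stableSpan _ _ (inr_mem_imageCosmash ?_)
    rw [map_mul, sigma₂, pair_apply, pair_apply]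
    simp only [desc_inl, desc_inr, NonUnitalAlgHom.zero_apply]
    exact Prod.ext (zero_mul _) (mul_zero _)

/-- Modulo the mixed elements, `X + (Y + Z)` is the amalgam of `X + Y` and `X + Z` over `X`. -/
theorem sub_keep_mem_mixedSpan (h : PullsOut K (coprod X (coprod Y Z)))
    (t : coprod X (coprod Y Z)) :
    t - keepXY X Y Z t - keepXZ X Y Z t + keepX X Y Z t ∈ mixedSpan X Y Z := by
  have hN := isAlgebraIdeal_mixedSpan h
  refine coprod₃_induction (t := t) ?_ ?_ ?_ ?_ ?_ ?_
  · intro x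
    simp [keepXY, keepXZ, keepX]
  · intro y
    simp [keepXY, keepXZ, keepX]
  · intro z
    simp [keepXY, keepXZ, keepX]
  · intro a b ha hb
    convert add_mem ha hb using 1
    simp only [map_add]
    abel
  · intro r a ha
    convert Submodule.smul_mem _ r ha using 1
    simp only [map_smul, smul_add, smul_sub]
  · intro a b ha hb
    -- Write `r` for the part in `X`, `r + u` and `r + v` for the parts without `Z` and without `Y`.
    -- Replacing `a` and `b` by `r + u + v` and `r' + u' + v'` costs an element of the ideal, and
    -- the remaining defect of the product is `uv' + vu'`.
    have h₁ := (h.idealSpan_mul_mem hN imageY_mul_imageZ_mem (keepXY_sub_keepX_mem a)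
      (keepXZ_sub_keepX_mem b)).1
    have h₂ := (h.idealSpan_mul_mem hN imageY_mul_imageZ_mem (keepXY_sub_keepX_mem b)
      (keepXZ_sub_keepX_mem a)).2
    have e := add_mem (add_mem (add_mem (hN b _ ha).2
      (hN (keepXY X Y Z a + keepXZ X Y Z a - keepX X Y Z a) _ hb).1) h₁) h₂
    convert e using 1
    simp only [map_mul, add_mul, sub_mul, mul_add, mul_sub]
    abel

/-- The range contains `Y ◇ Z` and is stable under multiplication by `X`, since `X` itself lies in
it; no pulling out is needed. -/
theorem mixedSpan_le_range :
    mixedSpan X Y Z ≤ LinearMap.range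
      (coprodMap (NonUnitalAlgHom.id K X) (cosmash₂Incl Y Z) :
        coprod X (cosmash₂ Y Z) →ₗ[K] coprod X (coprod Y Z)) := by
  refine stableSpan_le ?_ ?_
  · rintro _ ⟨c, rfl⟩
    exact ⟨inr X (cosmash₂ Y Z) c, desc_inr _ _ c⟩
  · rintro _ ⟨x, rfl⟩ _ ⟨s, rfl⟩
    have hx : coprodMap (NonUnitalAlgHom.id K X) (cosmash₂Incl Y Z) (inl X (cosmash₂ Y Z) x) =
      inl X (coprod Y Z) x := desc_inl _ _ x
    refine ⟨⟨inl X (cosmash₂ Y Z) x * s, ?_⟩, ⟨s * inl X (cosmash₂ Y Z) x, ?_⟩⟩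
    · change coprodMap _ _ _ = _ * coprodMap _ _ _
      rw [map_mul, hx]
    · change coprodMap _ _ _ = coprodMap _ _ _ * _
      rw [map_mul, hx]

theorem comparison_surjective (h : PullsOut K (coprod X (coprod Y Z))) :
    Function.Surjective (comparison X Y Z) := by
  rintro ⟨t, ht⟩
  have ht' : sigma₃ X Y Z t = 0 := ht
  have hXY : desc (inl X Y) (desc (inr X Y) 0) t = 0 := congrArg Prod.fst ht'
  have hXZ : desc (inl X Z) (desc 0 (inr X Z)) t = 0 := congrArg (fun p => p.2.1) ht'
  -- The partial projections factor through components of `Σ_{X,Y,Z}`, so they vanish on its kernel.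
  have eXY : keepXY X Y Z = (coprodMap (NonUnitalAlgHom.id K X) (inl Y Z)).comp
      (desc (inl X Y) (desc (inr X Y) 0)) := by
    apply coprod_hom_ext
    · intro x; simp [keepXY, coprodMap]
    · intro p
      refine mem_of_coprod (NonUnitalAlgHom.equalizer ((keepXY X Y Z).comp (inr X (coprod Y Z)))
        (((coprodMap (NonUnitalAlgHom.id K X) (inl Y Z)).comp
          (desc (inl X Y) (desc (inr X Y) 0))).comp (inr X (coprod Y Z)))) ?_ ?_ p <;>
      · intro y
        simp [NonUnitalAlgHom.mem_equalizer, keepXY, coprodMap]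
  have eXZ : keepXZ X Y Z = (coprodMap (NonUnitalAlgHom.id K X) (inr Y Z)).comp
      (desc (inl X Z) (desc 0 (inr X Z))) := by
    apply coprod_hom_ext
    · intro x; simp [keepXZ, coprodMap]
    · intro p
      refine mem_of_coprod (NonUnitalAlgHom.equalizer ((keepXZ X Y Z).comp (inr X (coprod Y Z)))
        (((coprodMap (NonUnitalAlgHom.id K X) (inr Y Z)).comp
          (desc (inl X Z) (desc 0 (inr X Z)))).comp (inr X (coprod Y Z)))) ?_ ?_ p <;>
      · intro y
        simp [NonUnitalAlgHom.mem_equalizer, keepXZ, coprodMap]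
  have eX : keepX X Y Z = (keepXY X Y Z).comp (keepXZ X Y Z) := by
    apply coprod_hom_ext
    · intro x; simp [keepX, keepXY, keepXZ]
    · intro p
      refine mem_of_coprod (NonUnitalAlgHom.equalizer ((keepX X Y Z).comp (inr X (coprod Y Z)))
        (((keepXY X Y Z).comp (keepXZ X Y Z)).comp (inr X (coprod Y Z)))) ?_ ?_ p <;>
      · intro y
        simp [NonUnitalAlgHom.mem_equalizer, keepX, keepXY, keepXZ]
  have kXY : keepXY X Y Z t = 0 := by rw [eXY, NonUnitalAlgHom.comp_apply, hXY, map_zero]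
  have kXZ : keepXZ X Y Z t = 0 := by rw [eXZ, NonUnitalAlgHom.comp_apply, hXZ, map_zero]
  have kX : keepX X Y Z t = 0 := by rw [eX, NonUnitalAlgHom.comp_apply, kXZ, map_zero]
  have hmem := sub_keep_mem_mixedSpan h t
  rw [kXY, kXZ, kX, sub_zero, sub_zero, add_zero] at hmem
  obtain ⟨s, hs⟩ := mixedSpan_le_range hmem
  replace hs : coprodMap (NonUnitalAlgHom.id K X) (cosmash₂Incl Y Z) s = t := hs
  -- The preimage `s` must itself lie in `X ◇ (Y ◇ Z)`. This follows from the commuting square,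
  -- whose right-hand vertical map is injective: `inl` has a retraction and `cosmash₂Incl` is a
  -- subalgebra inclusion.
  have hcomp := DFunLike.congr_fun (sigma₃_comp_coprodMap X Y Z) s
  rw [NonUnitalAlgHom.comp_apply, NonUnitalAlgHom.comp_apply, hs, ht'] at hcomp
  have hs₁ : inl X Y (sigma₂ X (cosmash₂ Y Z) s).1 = 0 := (congrArg Prod.fst hcomp).symm
  have hs₂ : cosmash₂Incl Y Z (sigma₂ X (cosmash₂ Y Z) s).2 = 0 :=
    (congrArg (fun p => p.2.2) hcomp).symm
  have hs₀ : sigma₂ X (cosmash₂ Y Z) s = 0 := by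
    refine Prod.ext ?_ ?_
    · have := congrArg (desc (NonUnitalAlgHom.id K X) 0) hs₁
      rwa [desc_inl, map_zero] at this
    · exact Subtype.ext hs₂
  exact ⟨⟨s, hs₀⟩, Subtype.ext hs⟩

end Surjectivity

end VarietyAlgebra

/-! ### The polarization of an algebra -/

/-- The tensor product of `A` with the augmentation ideal of `K[ε₀, ε₁, ε₂]/(ε₀², ε₁², ε₂²)`. The
components are the coefficients of the `εᵢ`, those of the products of all `εⱼ` with `j ≠ i`, and
that of `ε₀ε₁ε₂`. -/
def Polarization (A : Type*) := (Fin 3 → A) × (Fin 3 → A) × A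

namespace Polarization

variable {K : Type*} [Field K] {A : Type*} [NonUnitalNonAssocRing A] [Module K A]
  [IsScalarTower K A A] [SMulCommClass K A A]

instance : AddCommGroup (Polarization A) :=
  inferInstanceAs (AddCommGroup ((Fin 3 → A) × (Fin 3 → A) × A))

instance : Module K (Polarization A) :=
  inferInstanceAs (Module K ((Fin 3 → A) × (Fin 3 → A) × A))

variable (K A) in
/-- The coefficient of `εᵢ`. -/
def linear (i : Fin 3) : Polarization A →ₗ[K] A :=
  LinearMap.proj i ∘ₗ LinearMap.fst K (Fin 3 → A) ((Fin 3 → A) × A)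

variable (K A) in
/-- The coefficient of the product of all `εⱼ` with `j ≠ i`. -/
def quadratic (i : Fin 3) : Polarization A →ₗ[K] A :=
  LinearMap.proj i ∘ₗ LinearMap.fst K (Fin 3 → A) A ∘ₗ
    LinearMap.snd K (Fin 3 → A) ((Fin 3 → A) × A)

variable (K A) in
/-- The coefficient of `ε₀ε₁ε₂`. -/
def cubic : Polarization A →ₗ[K] A :=
  LinearMap.snd K (Fin 3 → A) A ∘ₗ LinearMap.snd K (Fin 3 → A) ((Fin 3 → A) × A)

variable (K) in
theorem ext {a b : Polarization A} (h₁ : ∀ i, linear K A i a = linear K A i b)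
    (h₂ : ∀ i, quadratic K A i a = quadratic K A i b) (h₃ : cubic K A a = cubic K A b) : a = b :=
  Prod.ext (funext h₁) (Prod.ext (funext h₂) h₃)

/-- Addition in `Fin 3` is cyclic, so `i + 1` and `i + 2` are the two indices other than `i`. Both
orders contribute because the `εᵢ` commute, and products have no linear part. -/
instance : Mul (Polarization A) where
  mul a b := (0, fun i => a.1 (i + 1) * b.1 (i + 2) + a.1 (i + 2) * b.1 (i + 1),
    ∑ i, (a.1 i * b.2.1 i + a.2.1 i * b.1 i))

variable (K) in
theorem linear_mul (i : Fin 3) (a b : Polarization A) : linear K A i (a * b) = 0 :=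
  rfl

variable (K) in
theorem quadratic_mul (i : Fin 3) (a b : Polarization A) : quadratic K A i (a * b) =
    linear K A (i + 1) a * linear K A (i + 2) b + linear K A (i + 2) a * linear K A (i + 1) b :=
  rfl

variable (K) in
theorem cubic_mul (a b : Polarization A) : cubic K A (a * b) =
    ∑ i, (linear K A i a * quadratic K A i b + quadratic K A i a * linear K A i b) :=
  rfl

instance : NonUnitalNonAssocRing (Polarization A) where
  left_distrib a b c := by
    refine Prod.ext ?_ (Prod.ext ?_ ?_)
    · exact (add_zero _).symm
    · funext i
      change a.1 (i + 1) * (b.1 (i + 2) + c.1 (i + 2)) + a.1 (i + 2) * (b.1 (i + 1) + c.1 (i + 1)) =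
        (a.1 (i + 1) * b.1 (i + 2) + a.1 (i + 2) * b.1 (i + 1)) +
          (a.1 (i + 1) * c.1 (i + 2) + a.1 (i + 2) * c.1 (i + 1))
      rw [mul_add, mul_add]; abel
    · change ∑ i, (a.1 i * (b.2.1 i + c.2.1 i) + a.2.1 i * (b.1 i + c.1 i)) =
        ∑ i, (a.1 i * b.2.1 i + a.2.1 i * b.1 i) + ∑ i, (a.1 i * c.2.1 i + a.2.1 i * c.1 i)
      rw [← Finset.sum_add_distrib]
      refine Finset.sum_congr rfl fun i _ => ?_
      rw [mul_add, mul_add]; abel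
  right_distrib a b c := by
    refine Prod.ext ?_ (Prod.ext ?_ ?_)
    · exact (add_zero _).symm
    · funext i
      change (a.1 (i + 1) + b.1 (i + 1)) * c.1 (i + 2) + (a.1 (i + 2) + b.1 (i + 2)) * c.1 (i + 1) =
        (a.1 (i + 1) * c.1 (i + 2) + a.1 (i + 2) * c.1 (i + 1)) +
          (b.1 (i + 1) * c.1 (i + 2) + b.1 (i + 2) * c.1 (i + 1))
      rw [add_mul, add_mul]; abel
    · change ∑ i, ((a.1 i + b.1 i) * c.2.1 i + (a.2.1 i + b.2.1 i) * c.1 i) =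
        ∑ i, (a.1 i * c.2.1 i + a.2.1 i * c.1 i) + ∑ i, (b.1 i * c.2.1 i + b.2.1 i * c.1 i)
      rw [← Finset.sum_add_distrib]
      refine Finset.sum_congr rfl fun i _ => ?_
      rw [add_mul, add_mul]; abel
  zero_mul a := by
    refine Prod.ext rfl (Prod.ext (funext fun i => ?_) ?_)
    · change 0 * a.1 (i + 2) + 0 * a.1 (i + 1) = 0
      rw [zero_mul, zero_mul, add_zero]
    · change ∑ i, (0 * a.2.1 i + 0 * a.1 i) = 0
      simp
  mul_zero a := by
    refine Prod.ext rfl (Prod.ext (funext fun i => ?_) ?_)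
    · change a.1 (i + 1) * 0 + a.1 (i + 2) * 0 = 0
      rw [mul_zero, mul_zero, add_zero]
    · change ∑ i, (a.1 i * 0 + a.2.1 i * 0) = 0
      simp

instance : IsScalarTower K (Polarization A) (Polarization A) where
  smul_assoc r a b := by
    refine ext K ?_ ?_ ?_ <;>
      simp [linear_mul, quadratic_mul, cubic_mul, smul_mul_assoc, Finset.smul_sum, smul_add]

instance : SMulCommClass K (Polarization A) (Polarization A) where
  smul_comm r a b := by
    refine ext K ?_ ?_ ?_ <;>
      simp [linear_mul, quadratic_mul, cubic_mul, mul_smul_comm, Finset.smul_sum, smul_add]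

end Polarization

/-! ### Words of length at most three -/

section Words

variable {σ : Type*}

theorem card_wordType_pos (w : FreeMagma σ) : 0 < (wordType w).card := by
  induction w using FreeMagma.recOnMul with
  | ih1 x => exact Nat.one_pos
  | ih2 u v hu hv =>
    change 0 < (wordType u + wordType v).card
    rw [Multiset.card_add]; omega

theorem card_wordType_mul (u v : FreeMagma σ) :
    (wordType (u * v)).card = (wordType u).card + (wordType v).card :=
  Multiset.card_add _ _

theorem eq_of_card_wordType_eq_one {w : FreeMagma σ} (h : (wordType w).card = 1) :
    ∃ x, w = FreeMagma.of x := by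
  induction w using FreeMagma.recOnMul with
  | ih1 x => exact ⟨x, rfl⟩
  | ih2 u v _ _ =>
    have := card_wordType_pos u
    have := card_wordType_pos v
    rw [card_wordType_mul] at h
    omega

theorem exists_mul_of_one_lt_card_wordType {w : FreeMagma σ} (h : 1 < (wordType w).card) :
    ∃ u v, w = u * v ∧ (wordType w).card = (wordType u).card + (wordType v).card := by
  induction w using FreeMagma.recOnMul with
  | ih1 x => exact absurd h (lt_irrefl 1)
  | ih2 u v _ _ => exact ⟨u, v, rfl, card_wordType_mul u v⟩

theorem eq_of_card_wordType_eq_two {w : FreeMagma σ} (h : (wordType w).card = 2) :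
    ∃ x y, w = FreeMagma.of x * FreeMagma.of y := by
  obtain ⟨u, v, rfl, e⟩ := exists_mul_of_one_lt_card_wordType (w := w) (by omega)
  have := card_wordType_pos u
  have := card_wordType_pos v
  obtain ⟨x, rfl⟩ := eq_of_card_wordType_eq_one (w := u) (by omega)
  obtain ⟨y, rfl⟩ := eq_of_card_wordType_eq_one (w := v) (by omega)
  exact ⟨x, y, rfl⟩

theorem eq_of_card_wordType_eq_three {w : FreeMagma σ} (h : (wordType w).card = 3) :
    ∃ x y z, w = (FreeMagma.of x * FreeMagma.of y) * FreeMagma.of z ∨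
      w = FreeMagma.of x * (FreeMagma.of y * FreeMagma.of z) := by
  obtain ⟨u, v, rfl, e⟩ := exists_mul_of_one_lt_card_wordType (w := w) (by omega)
  have := card_wordType_pos u
  have := card_wordType_pos v
  obtain hu | hu : (wordType u).card = 2 ∨ (wordType u).card = 1 := by omega
  · obtain ⟨x, y, rfl⟩ := eq_of_card_wordType_eq_two hu
    obtain ⟨z, rfl⟩ := eq_of_card_wordType_eq_one (w := v) (by omega)
    exact ⟨x, y, z, Or.inl rfl⟩
  · obtain ⟨y, z, rfl⟩ := eq_of_card_wordType_eq_two (w := v) (by omega)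
    obtain ⟨x, rfl⟩ := eq_of_card_wordType_eq_one hu
    exact ⟨x, y, z, Or.inr rfl⟩

end Words

/-! ### Homogeneous identities pass to the polarization -/

section Evaluation

variable {K : Type*} [Field K] {σ : Type*} {A : Type*} [NonUnitalNonAssocRing A] [Module K A]
  [IsScalarTower K A A] [SMulCommClass K A A]

/-- Evaluation of polynomials, as a linear map. -/
noncomputable def eval (K : Type*) [Field K] {σ : Type*} {A : Type*} [NonUnitalNonAssocRing A]
    [Module K A] [IsScalarTower K A A] [SMulCommClass K A A] (a : σ → A) :
    FreeNonUnitalNonAssocAlgebra K σ →ₗ[K] A :=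
  (FreeNonUnitalNonAssocAlgebra.lift K a : FreeNonUnitalNonAssocAlgebra K σ →ₗ[K] A)

/-- The polynomial given by a word. -/
noncomputable def monomial (K : Type*) [Field K] {σ : Type*} (w : FreeMagma σ) :
    FreeNonUnitalNonAssocAlgebra K σ :=
  MonoidAlgebra.ofMagma K _ w

theorem eval_monomial_of (a : σ → A) (x : σ) : eval K a (monomial K (FreeMagma.of x)) = a x :=
  FreeNonUnitalNonAssocAlgebra.lift_of_apply K a x

theorem eval_monomial_mul (a : σ → A) (u v : FreeMagma σ) :
    eval K a (monomial K (u * v)) = eval K a (monomial K u) * eval K a (monomial K v) := by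
  simp only [monomial, map_mul]
  exact map_mul (FreeNonUnitalNonAssocAlgebra.lift K a) _ _

/-- Linear maps that agree on the monomials of a polynomial agree on the polynomial. -/
theorem eq_of_eq_on_monomials {M : Type*} [AddCommGroup M] [Module K M]
    (φ : FreeNonUnitalNonAssocAlgebra K σ) (f g : FreeNonUnitalNonAssocAlgebra K σ →ₗ[K] M)
    (h : ∀ w ∈ φ.coeff.support, f (monomial K w) = g (monomial K w)) : f φ = g φ := by
  have e : ∀ (w : FreeMagma σ) (c : K), MonoidAlgebra.single w c = c • monomial K w := by
    intro w c
    simp [monomial, MonoidAlgebra.ofMagma]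
  rw [← MonoidAlgebra.sum_coeff_single φ, Finsupp.sum, map_sum, map_sum]
  refine Finset.sum_congr rfl fun w hw => ?_
  rw [e, map_smul, map_smul, h w hw]

namespace Polarization

variable (b : σ → Polarization A)

/-- This and the next two lemmas express that all elements have positive degree in the `εᵢ`, so a
word of length `n` has no terms of degree below `n`, and none at all once `n ≥ 4`. -/
theorem linear_eval_of_two_le {w : FreeMagma σ} (hw : 2 ≤ (wordType w).card) (i : Fin 3) :
    linear K A i (eval K b (monomial K w)) = 0 := by
  obtain ⟨u, v, rfl, -⟩ := exists_mul_of_one_lt_card_wordType hw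
  rw [eval_monomial_mul, linear_mul]

theorem quadratic_eval_of_three_le {w : FreeMagma σ} (hw : 3 ≤ (wordType w).card) (i : Fin 3) :
    quadratic K A i (eval K b (monomial K w)) = 0 := by
  obtain ⟨u, v, rfl, e⟩ := exists_mul_of_one_lt_card_wordType (w := w) (by omega)
  rw [eval_monomial_mul, quadratic_mul]
  obtain hu | hv : 2 ≤ (wordType u).card ∨ 2 ≤ (wordType v).card := by omega
  · simp [linear_eval_of_two_le b hu]
  · simp [linear_eval_of_two_le b hv]

theorem cubic_eval_of_four_le {w : FreeMagma σ} (hw : 4 ≤ (wordType w).card) :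
    cubic K A (eval K b (monomial K w)) = 0 := by
  obtain ⟨u, v, rfl, e⟩ := exists_mul_of_one_lt_card_wordType (w := w) (by omega)
  rw [eval_monomial_mul, cubic_mul]
  refine Finset.sum_eq_zero fun i _ => ?_
  have := card_wordType_pos u
  have := card_wordType_pos v
  obtain hu | ⟨hu, hv⟩ | hv : 3 ≤ (wordType u).card ∨
      (2 ≤ (wordType u).card ∧ 2 ≤ (wordType v).card) ∨ 3 ≤ (wordType v).card := by omega
  · rw [linear_eval_of_two_le b (by omega), quadratic_eval_of_three_le b hu, zero_mul, zero_mul,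
      add_zero]
  · rw [linear_eval_of_two_le b hu, linear_eval_of_two_le b hv, zero_mul, mul_zero, add_zero]
  · rw [linear_eval_of_two_le b (w := v) (by omega), quadratic_eval_of_three_le b hv, mul_zero,
      mul_zero, add_zero]

variable {b} {φ : FreeNonUnitalNonAssocAlgebra K σ} {d : ℕ}

theorem linear_eval_eq_zero (hφ : IsIdentity A φ)
    (hd : ∀ w ∈ φ.coeff.support, (wordType w).card = d) (i : Fin 3) :
    linear K A i (eval K b φ) = 0 := by
  by_cases h : d = 1
  · subst h
    have := eq_of_eq_on_monomials φ (linear K A i ∘ₗ eval K b)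
      (eval K fun s => linear K A i (b s)) (by
        intro w hw
        obtain ⟨x, rfl⟩ := eq_of_card_wordType_eq_one (hd w hw)
        simp only [LinearMap.comp_apply, eval_monomial_of])
    exact this.trans (hφ _)
  · refine eq_of_eq_on_monomials φ (linear K A i ∘ₗ eval K b) 0 fun w hw => ?_
    have := card_wordType_pos w
    exact linear_eval_of_two_le b (by rw [hd w hw] at *; omega) i

/-- In degree one the coefficient is a value of `φ`; in degree two it is the polarization `φ(a + b)
- φ(a) - φ(b)` at the two linear coefficients; in higher degree it is zero. -/
theorem quadratic_eval_eq_zero (hφ : IsIdentity A φ)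
    (hd : ∀ w ∈ φ.coeff.support, (wordType w).card = d) (i : Fin 3) :
    quadratic K A i (eval K b φ) = 0 := by
  have hφ' : ∀ a : σ → A, eval K a φ = 0 := hφ
  obtain rfl | rfl | h : d = 1 ∨ d = 2 ∨ (d ≠ 1 ∧ d ≠ 2) := by omega
  · have := eq_of_eq_on_monomials φ (quadratic K A i ∘ₗ eval K b)
      (eval K fun s => quadratic K A i (b s)) (by
        intro w hw
        obtain ⟨x, rfl⟩ := eq_of_card_wordType_eq_one (hd w hw)
        simp only [LinearMap.comp_apply, eval_monomial_of])
    exact this.trans (hφ _)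
  · have := eq_of_eq_on_monomials φ (quadratic K A i ∘ₗ eval K b)
      ((eval K fun s => linear K A (i + 1) (b s) + linear K A (i + 2) (b s)) -
        (eval K fun s => linear K A (i + 1) (b s)) - eval K fun s => linear K A (i + 2) (b s)) (by
        intro w hw
        obtain ⟨x, y, rfl⟩ := eq_of_card_wordType_eq_two (hd w hw)
        simp only [LinearMap.comp_apply, LinearMap.sub_apply, eval_monomial_of, eval_monomial_mul,
          quadratic_mul, mul_add, add_mul]
        abel)
    simpa only [LinearMap.comp_apply, LinearMap.sub_apply, hφ', sub_zero] using this
  · refine eq_of_eq_on_monomials φ (quadratic K A i ∘ₗ eval K b) 0 fun w hw => ?_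
    have := card_wordType_pos w
    exact quadratic_eval_of_three_le b (by rw [hd w hw] at *; omega) i

theorem cubic_eval_eq_zero (hφ : IsIdentity A φ)
    (hd : ∀ w ∈ φ.coeff.support, (wordType w).card = d) :
    cubic K A (eval K b φ) = 0 := by
  have hφ' : ∀ a : σ → A, eval K a φ = 0 := hφ
  obtain rfl | rfl | rfl | h : d = 1 ∨ d = 2 ∨ d = 3 ∨ (d ≠ 1 ∧ d ≠ 2 ∧ d ≠ 3) := by omega
  · have := eq_of_eq_on_monomials φ (cubic K A ∘ₗ eval K b)
      (eval K fun s => cubic K A (b s)) (by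
        intro w hw
        obtain ⟨x, rfl⟩ := eq_of_card_wordType_eq_one (hd w hw)
        simp only [LinearMap.comp_apply, eval_monomial_of])
    exact this.trans (hφ _)
  -- In degree two, `ε₀ε₁ε₂` arises only as some `εᵢ` times the product of the other two, which
  -- gives one polarization of `φ` for each `i`.
  · have := eq_of_eq_on_monomials φ (cubic K A ∘ₗ eval K b)
      (∑ i, ((eval K fun s => linear K A i (b s) + quadratic K A i (b s)) -
        (eval K fun s => linear K A i (b s)) - eval K fun s => quadratic K A i (b s))) (by
        intro w hw
        obtain ⟨x, y, rfl⟩ := eq_of_card_wordType_eq_two (hd w hw)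
        simp only [LinearMap.comp_apply, LinearMap.sum_apply, LinearMap.sub_apply,
          eval_monomial_of, eval_monomial_mul, cubic_mul]
        refine Finset.sum_congr rfl fun i _ => ?_
        simp only [mul_add, add_mul]
        abel)
    simpa only [LinearMap.comp_apply, LinearMap.sum_apply, LinearMap.sub_apply, hφ', sub_zero,
      Finset.sum_const_zero] using this
  -- In degree three, inclusion-exclusion over the nonempty sets of linear coefficients isolates the
  -- terms using each of the three exactly once.
  · have := eq_of_eq_on_monomials φ (cubic K A ∘ₗ eval K b)
      ((eval K fun s => linear K A 0 (b s) + linear K A 1 (b s) + linear K A 2 (b s)) -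
        (eval K fun s => linear K A 0 (b s) + linear K A 1 (b s)) -
        (eval K fun s => linear K A 0 (b s) + linear K A 2 (b s)) -
        (eval K fun s => linear K A 1 (b s) + linear K A 2 (b s)) +
        (eval K fun s => linear K A 0 (b s)) + (eval K fun s => linear K A 1 (b s)) +
        eval K fun s => linear K A 2 (b s)) (by
        intro w hw
        have e₁ : (1 : Fin 3) + 1 = 2 := rfl
        have e₂ : (1 : Fin 3) + 2 = 0 := rfl
        have e₃ : (2 : Fin 3) + 1 = 0 := rfl
        have e₄ : (2 : Fin 3) + 2 = 1 := rfl
        obtain ⟨x, y, z, rfl | rfl⟩ := eq_of_card_wordType_eq_three (hd w hw) <;>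
        · simp only [LinearMap.comp_apply, LinearMap.add_apply, LinearMap.sub_apply,
            eval_monomial_of, eval_monomial_mul, cubic_mul, quadratic_mul, linear_mul,
            Fin.sum_univ_three, zero_add, e₁, e₂, e₃, e₄, zero_mul, mul_zero, add_zero,
            mul_add, add_mul]
          abel)
    simpa only [LinearMap.comp_apply, LinearMap.sub_apply, LinearMap.add_apply, hφ', sub_zero,
      add_zero] using this
  · refine eq_of_eq_on_monomials φ (cubic K A ∘ₗ eval K b) 0 fun w hw => ?_
    have := card_wordType_pos w
    exact cubic_eval_of_four_le b (by rw [hd w hw] at *; omega)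

/-- Homogeneous identities of `A` are identities of its polarization. -/
theorem isIdentity (hφ : IsHomogeneous φ) (h : IsIdentity A φ) :
    IsIdentity (Polarization A) φ := by
  obtain ⟨d, hd⟩ : ∃ d, ∀ w ∈ φ.coeff.support, (wordType w).card = d := by
    obtain he | ⟨w₀, hw₀⟩ := φ.coeff.support.eq_empty_or_nonempty
    -- The zero polynomial has no monomials, so any degree serves.
    · exact ⟨0, by simp [he]⟩
    · exact ⟨_, fun w hw => congrArg Multiset.card (hφ w hw w₀ hw₀)⟩
  intro b
  change eval K b φ = 0
  refine ext K (fun i => ?_) (fun i => ?_) ?_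
  · rw [linear_eval_eq_zero h hd, map_zero]
  · rw [quadratic_eval_eq_zero h hd, map_zero]
  · rw [cubic_eval_eq_zero h hd, map_zero]

end Polarization

end Evaluation

/-! ### Lines in the polarization and products with `x` outside -/

namespace Polarization

variable {K : Type*} [Field K] {A : Type*} [NonUnitalNonAssocRing A] [Module K A]
  [IsScalarTower K A A] [SMulCommClass K A A]

/-- The element `εᵢ x`. -/
def gen (i : Fin 3) (x : A) : Polarization A :=
  (Pi.single i x, 0, 0)

variable (K) in
theorem linear_gen (i j : Fin 3) (x : A) : linear K A j (gen i x) = if j = i then x else 0 :=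
  Pi.single_apply i x j

variable (K) in
theorem quadratic_gen (i j : Fin 3) (x : A) : quadratic K A j (gen i x) = 0 :=
  rfl

variable (K) in
theorem cubic_gen (i : Fin 3) (x : A) : cubic K A (gen i x) = 0 :=
  rfl

/-- This is `εᵢ² = 0`; it makes each line a subalgebra. -/
theorem gen_mul_gen_self (i : Fin 3) (x y : A) : gen i x * gen i y = 0 := by
  refine Prod.ext rfl (Prod.ext (funext fun j => ?_) ?_)
  · change Pi.single (M := fun _ => A) i x (j + 1) * Pi.single (M := fun _ => A) i y (j + 2) +
      Pi.single (M := fun _ => A) i x (j + 2) * Pi.single (M := fun _ => A) i y (j + 1) = 0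
    simp only [Pi.single_apply]
    fin_cases i <;> fin_cases j <;> simp
  · change ∑ j, (Pi.single (M := fun _ => A) i x j * 0 + 0 * Pi.single (M := fun _ => A) i y j) = 0
    simp

variable (K) in
/-- The line through `εᵢ x`, a subalgebra with zero multiplication. -/
def line (i : Fin 3) (x : A) : NonUnitalSubalgebra K (Polarization A) where
  __ := Submodule.span K {gen i x}
  mul_mem' {a b} ha hb := by
    obtain ⟨r, rfl⟩ := Submodule.mem_span_singleton.1 ha
    obtain ⟨s, rfl⟩ := Submodule.mem_span_singleton.1 hb
    rw [smul_mul_assoc, mul_smul_comm, gen_mul_gen_self, smul_zero, smul_zero]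
    exact zero_mem (Submodule.span K {gen i x})

theorem mem_line {i : Fin 3} {x : A} {b : Polarization A} :
    b ∈ line K i x ↔ ∃ r : K, r • gen i x = b :=
  Submodule.mem_span_singleton

variable (K) in
theorem gen_mem_line (i : Fin 3) (x : A) : gen i x ∈ line K i x :=
  Submodule.mem_span_singleton_self _

variable (K) in
/-- The subspace spanned by the products of `x`, `y`, `z` in which `x` stands outside the
parentheses. -/
def outerSpan (x y z : A) : Submodule K A :=
  Submodule.span K (Set.range ![x * (y * z), x * (z * y), (y * z) * x, (z * y) * x])

theorem mem_outerSpan {x y z a : A} : a ∈ outerSpan K x y z ↔ ∃ c : Fin 4 → K,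
    a = c 0 • (x * (y * z)) + c 1 • (x * (z * y)) + c 2 • ((y * z) * x) + c 3 • ((z * y) * x) := by
  rw [outerSpan, Submodule.mem_span_range_iff_exists_fun]
  simp only [Fin.sum_univ_four, eq_comm (a := a)]
  rfl

theorem mul_mem_outerSpan {x y z a b : A} (ha : a ∈ Submodule.span K {x})
    (hb : b ∈ Submodule.span K {y * z, z * y}) :
    a * b ∈ outerSpan K x y z ∧ b * a ∈ outerSpan K x y z := by
  obtain ⟨r, rfl⟩ := Submodule.mem_span_singleton.1 ha
  obtain ⟨s, t, rfl⟩ := Submodule.mem_span_pair.1 hb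
  constructor
  · refine mem_outerSpan.2 ⟨![r * s, r * t, 0, 0], ?_⟩
    simp [mul_add, smul_mul_assoc, mul_smul_comm, mul_smul, smul_comm r]
  · refine mem_outerSpan.2 ⟨![0, 0, r * s, r * t], ?_⟩
    simp [add_mul, smul_mul_assoc, mul_smul_comm, mul_smul, smul_comm r]

variable (K) in
/-- A subalgebra containing `ε₀ x` and the elements `ε₁ε₂ (y z)` and `ε₁ε₂ (z y)`. -/
def outerSubalgebra (x y z : A) : NonUnitalSubalgebra K (Polarization A) where
  carrier := {b | linear K A 0 b ∈ Submodule.span K {x} ∧ linear K A 1 b = 0 ∧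
    linear K A 2 b = 0 ∧ quadratic K A 0 b ∈ Submodule.span K {y * z, z * y} ∧
    quadratic K A 1 b = 0 ∧ quadratic K A 2 b = 0 ∧ cubic K A b ∈ outerSpan K x y z}
  zero_mem' := by simp
  add_mem' := by
    rintro a b ⟨h₁, h₂, h₃, h₄, h₅, h₆, h₇⟩ ⟨k₁, k₂, k₃, k₄, k₅, k₆, k₇⟩
    simp only [Set.mem_ofPred_eq, map_add, h₂, h₃, h₅, h₆, k₂, k₃, k₅, k₆, add_zero, true_and]
    exact ⟨add_mem h₁ k₁, add_mem h₄ k₄, add_mem h₇ k₇⟩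
  smul_mem' := by
    rintro r a ⟨h₁, h₂, h₃, h₄, h₅, h₆, h₇⟩
    simp only [Set.mem_ofPred_eq, map_smul, h₂, h₃, h₅, h₆, smul_zero, true_and]
    exact ⟨Submodule.smul_mem _ r h₁, Submodule.smul_mem _ r h₄, Submodule.smul_mem _ r h₇⟩
  mul_mem' := by
    rintro a b ⟨h₁, h₂, h₃, h₄, h₅, h₆, h₇⟩ ⟨k₁, k₂, k₃, k₄, k₅, k₆, k₇⟩
    have e₁ : (1 : Fin 3) + 1 = 2 := rfl
    have e₂ : (1 : Fin 3) + 2 = 0 := rfl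
    have e₃ : (2 : Fin 3) + 1 = 0 := rfl
    have e₄ : (2 : Fin 3) + 2 = 1 := rfl
    simp only [Set.mem_ofPred_eq, linear_mul, quadratic_mul, cubic_mul, Fin.sum_univ_three,
      zero_add, e₁, e₂, e₃, e₄, h₂, h₃, h₅, h₆, k₂, k₃, k₅, k₆, zero_mul, mul_zero, add_zero,
      zero_mem, true_and]
    exact add_mem (mul_mem_outerSpan h₁ k₄).1 (mul_mem_outerSpan k₁ h₄).2

variable (K) in
/-- `b` is a combination of `ε₁ y`, `ε₂ z`, `ε₁ε₂ (y z)` and `ε₁ε₂ (z y)`, with the first two terms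
as in `p` and in `q`. -/
def IsSplit (y z : A) (b p q : Polarization A) : Prop :=
  linear K A 0 b = 0 ∧
    (linear K A 1 b ∈ Submodule.span K {y} ∧ linear K A 1 b = linear K A 1 p) ∧
    (linear K A 2 b ∈ Submodule.span K {z} ∧ linear K A 2 b = linear K A 2 q) ∧
    quadratic K A 0 b ∈ Submodule.span K {y * z, z * y} ∧
    quadratic K A 1 b = 0 ∧ quadratic K A 2 b = 0 ∧ cubic K A b = 0

namespace IsSplit

variable {y z : A} {b b' p p' q q' : Polarization A}

theorem add (h : IsSplit K y z b p q) (k : IsSplit K y z b' p' q') :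
    IsSplit K y z (b + b') (p + p') (q + q') := by
  obtain ⟨h₁, ⟨h₂, h₂'⟩, ⟨h₃, h₃'⟩, h₄, h₅, h₆, h₇⟩ := h
  obtain ⟨k₁, ⟨k₂, k₂'⟩, ⟨k₃, k₃'⟩, k₄, k₅, k₆, k₇⟩ := k
  refine ⟨?_, ⟨?_, ?_⟩, ⟨?_, ?_⟩, ?_, ?_, ?_, ?_⟩
  · rw [map_add, h₁, k₁, add_zero]
  · rw [map_add]; exact add_mem h₂ k₂
  · rw [map_add, map_add, h₂', k₂']
  · rw [map_add]; exact add_mem h₃ k₃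
  · rw [map_add, map_add, h₃', k₃']
  · rw [map_add]; exact add_mem h₄ k₄
  · rw [map_add, h₅, k₅, add_zero]
  · rw [map_add, h₆, k₆, add_zero]
  · rw [map_add, h₇, k₇, add_zero]

theorem smul (r : K) (h : IsSplit K y z b p q) : IsSplit K y z (r • b) (r • p) (r • q) := by
  obtain ⟨h₁, ⟨h₂, h₂'⟩, ⟨h₃, h₃'⟩, h₄, h₅, h₆, h₇⟩ := h
  refine ⟨?_, ⟨?_, ?_⟩, ⟨?_, ?_⟩, ?_, ?_, ?_, ?_⟩
  · rw [map_smul, h₁, smul_zero]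
  · rw [map_smul]; exact Submodule.smul_mem _ r h₂
  · rw [map_smul, map_smul, h₂']
  · rw [map_smul]; exact Submodule.smul_mem _ r h₃
  · rw [map_smul, map_smul, h₃']
  · rw [map_smul]; exact Submodule.smul_mem _ r h₄
  · rw [map_smul, h₅, smul_zero]
  · rw [map_smul, h₆, smul_zero]
  · rw [map_smul, h₇, smul_zero]

theorem mul (h : IsSplit K y z b p q) (k : IsSplit K y z b' p' q') :
    IsSplit K y z (b * b') (p * p') (q * q') := by
  obtain ⟨h₁, ⟨h₂, -⟩, ⟨h₃, -⟩, h₄, h₅, h₆, h₇⟩ := h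
  obtain ⟨k₁, ⟨k₂, -⟩, ⟨k₃, -⟩, k₄, k₅, k₆, k₇⟩ := k
  have e₁ : (1 : Fin 3) + 1 = 2 := rfl
  have e₂ : (1 : Fin 3) + 2 = 0 := rfl
  have e₃ : (2 : Fin 3) + 1 = 0 := rfl
  have e₄ : (2 : Fin 3) + 2 = 1 := rfl
  -- All three products have zero linear part, so the comparison with `p * p'` and `q * q'` is
  -- trivial. The new `ε₁ε₂` term comes from `y` against `z`; nothing cubic arises, since `ε₁ε₂` is
  -- annihilated by `ε₁` and `ε₂`.
  refine ⟨rfl, ⟨zero_mem _, rfl⟩, ⟨zero_mem _, rfl⟩, ?_, ?_, ?_, ?_⟩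
  · obtain ⟨r, hr⟩ := Submodule.mem_span_singleton.1 h₂
    obtain ⟨r', hr'⟩ := Submodule.mem_span_singleton.1 k₂
    obtain ⟨s, hs⟩ := Submodule.mem_span_singleton.1 h₃
    obtain ⟨s', hs'⟩ := Submodule.mem_span_singleton.1 k₃
    rw [quadratic_mul, zero_add, zero_add, ← hr, ← hr', ← hs, ← hs']
    refine Submodule.mem_span_pair.2 ⟨r * s', s * r', ?_⟩
    simp only [smul_mul_assoc, mul_smul_comm, mul_smul, smul_comm s', smul_comm r']
  · rw [quadratic_mul, e₁, e₂, h₁, k₁, mul_zero, zero_mul, add_zero]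
  · rw [quadratic_mul, e₃, e₄, h₁, k₁, mul_zero, zero_mul, add_zero]
  · rw [cubic_mul, Fin.sum_univ_three, h₁, k₁, h₅, h₆, k₅, k₆]
    simp

theorem gen_one : IsSplit K y z (gen 1 y) (gen 1 y) 0 := by
  refine ⟨?_, ⟨?_, ?_⟩, ⟨?_, ?_⟩, ?_, ?_, ?_, ?_⟩ <;>
    simp [linear_gen, quadratic_gen, cubic_gen, Submodule.mem_span_singleton_self]

theorem gen_two : IsSplit K y z (gen 2 z) 0 (gen 2 z) := by
  refine ⟨?_, ⟨?_, ?_⟩, ⟨?_, ?_⟩, ?_, ?_, ?_, ?_⟩ <;>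
    simp [linear_gen, quadratic_gen, cubic_gen, Submodule.mem_span_singleton_self]

end IsSplit

end Polarization

/-! ### Necessity: testing surjectivity on three lines -/

namespace VarietyAlgebra

open Polarization

variable {K : Type u} [Field K] {σ : Type w} {I : Set (FreeNonUnitalNonAssocAlgebra K σ)}

/-- The polarization of an algebra of a homogeneous variety. -/
abbrev polarization (hI : ∀ φ ∈ I, IsHomogeneous φ) (A : VarietyAlgebra.{u, v, w} I) :
    VarietyAlgebra.{u, v, w} I where
  carrier := Polarization A
  isIdentity φ hφ := Polarization.isIdentity (hI φ hφ) (A.isIdentity φ hφ)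

section Necessity

variable (hI : ∀ φ ∈ I, IsHomogeneous φ) {A : VarietyAlgebra.{u, v, w} I}

/-- The line through `εᵢ x`, as an algebra of the variety. -/
noncomputable def lineAlgebra (i : Fin 3) (x : A) : VarietyAlgebra.{u, v, w} I :=
  ofSubalgebra (polarization hI A) (line K i x)

/-- The inclusion of the line through `εᵢ x` into the polarization. -/
noncomputable def lineIncl (i : Fin 3) (x : A) : lineAlgebra hI i x →ₙₐ[K] polarization hI A :=
  NonUnitalSubalgebraClass.subtype (line K i x)

/-- The generator of the line through `εᵢ x`. -/
noncomputable def lineGen (i : Fin 3) (x : A) : lineAlgebra hI i x :=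
  ⟨gen i x, gen_mem_line K i x⟩

theorem exists_smul_gen_eq_lineIncl (i : Fin 3) (x : A) (a : lineAlgebra hI i x) :
    ∃ r : K, lineIncl hI i x a = r • gen i x :=
  (mem_line.1 a.2).imp fun _ h => h.symm

/-- Ties the linear coefficients of the image of `t` to its projections to the two lines, so that
they vanish when `t` is in the cosmash product. -/
theorem isSplit_desc_lineIncl (y z : A)
    (t : coprod (lineAlgebra hI 1 y) (lineAlgebra hI 2 z)) :
    IsSplit K y z (desc (lineIncl hI 1 y) (lineIncl hI 2 z) t)
      (lineIncl hI 1 y (desc (NonUnitalAlgHom.id K _) 0 t))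
      (lineIncl hI 2 z (desc 0 (NonUnitalAlgHom.id K _) t)) := by
  refine coprod_induction (t := t) ?_ ?_ ?_ ?_ ?_
  · intro a
    obtain ⟨r, hr⟩ := exists_smul_gen_eq_lineIncl hI 1 y a
    rw [desc_inl, desc_inl, desc_inl, NonUnitalAlgHom.coe_id, id_eq, NonUnitalAlgHom.zero_apply,
      map_zero, hr, ← smul_zero r]
    exact IsSplit.gen_one.smul r
  · intro a
    obtain ⟨r, hr⟩ := exists_smul_gen_eq_lineIncl hI 2 z a
    rw [desc_inr, desc_inr, desc_inr, NonUnitalAlgHom.coe_id, id_eq, NonUnitalAlgHom.zero_apply,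
      map_zero, hr, ← smul_zero r]
    exact IsSplit.gen_two.smul r
  · intro a b ha hb
    simp only [map_add]
    exact ha.add hb
  · intro r a ha
    simp only [map_smul]
    exact ha.smul r
  · intro a b ha hb
    simp only [map_mul]
    exact ha.mul hb

/-- Only the two summands need checking. The line contributes multiples of `ε₀x`; an element of the
cosmash product has zero projections, hence keeps only its `ε₁ε₂` term. -/
theorem desc_lineIncl_mem_outerSubalgebra (x y z : A)
    (s : coprod (lineAlgebra hI 0 x) (cosmash₂ (lineAlgebra hI 1 y) (lineAlgebra hI 2 z))) :
    (desc (lineIncl hI 0 x) (desc (lineIncl hI 1 y) (lineIncl hI 2 z))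
      (coprodMap (NonUnitalAlgHom.id K _) (cosmash₂Incl _ _) s) : Polarization A) ∈
        outerSubalgebra K x y z := by
  refine mem_of_coprod ((outerSubalgebra K x y z).comap
    ((desc (lineIncl hI 0 x) (desc (lineIncl hI 1 y) (lineIncl hI 2 z))).comp
      (coprodMap (NonUnitalAlgHom.id K _) (cosmash₂Incl _ _)))) ?_ ?_ s
  · intro a
    rw [NonUnitalSubalgebra.mem_comap, NonUnitalAlgHom.comp_apply, coprodMap, desc_inl,
      NonUnitalAlgHom.comp_apply, desc_inl, NonUnitalAlgHom.coe_id, id_eq]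
    obtain ⟨r, hr⟩ := exists_smul_gen_eq_lineIncl hI 0 x a
    rw [hr]
    refine (outerSubalgebra K x y z).smul_mem' r ?_
    refine ⟨?_, ?_, ?_, ?_, ?_, ?_, ?_⟩ <;>
      simp [linear_gen, quadratic_gen, cubic_gen, Submodule.mem_span_singleton_self]
  · intro c
    rw [NonUnitalSubalgebra.mem_comap, NonUnitalAlgHom.comp_apply, coprodMap, desc_inr,
      NonUnitalAlgHom.comp_apply, desc_inr]
    obtain ⟨h₁, ⟨-, h₂⟩, ⟨-, h₃⟩, h₄, h₅, h₆, h₇⟩ :=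
      isSplit_desc_lineIncl hI y z (cosmash₂Incl _ _ c)
    rw [desc_id_zero_cosmash₂Incl, map_zero] at h₂
    rw [desc_zero_id_cosmash₂Incl, map_zero] at h₃
    refine ⟨?_, h₂.trans (map_zero (linear K A 1)), h₃.trans (map_zero (linear K A 2)), h₄, h₅, h₆, ?_⟩
    · rw [h₁]; exact zero_mem _
    · rw [h₇]; exact zero_mem _

/-- If all comparison maps are surjective, then `x` can be pulled out of parentheses. -/
theorem mem_outerSpan_of_surjective
    (hI : ∀ φ ∈ I, IsHomogeneous φ)
    (h : ∀ X Y Z : VarietyAlgebra.{u, v, w} I, Function.Surjective (comparison X Y Z))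
    (x y z : A) :
    (x * y) * z ∈ outerSpan K x y z ∧ (y * x) * z ∈ outerSpan K x y z ∧
      z * (x * y) ∈ outerSpan K x y z ∧ z * (y * x) ∈ outerSpan K x y z := by
  set X := lineAlgebra hI 0 x
  set Y := lineAlgebra hI 1 y
  set Z := lineAlgebra hI 2 z
  set f : coprod X (coprod Y Z) →ₙₐ[K] polarization hI A :=
    desc (lineIncl hI 0 x) (desc (lineIncl hI 1 y) (lineIncl hI 2 z))
  have key : ∀ t, sigma₃ X Y Z t = 0 → cubic K A (f t) ∈ outerSpan K x y z := by
    intro t ht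
    obtain ⟨c, hc⟩ := h X Y Z ⟨t, ht⟩
    have hc' : coprodMap (NonUnitalAlgHom.id K X) (cosmash₂Incl Y Z)
      (cosmash₂Incl X (cosmash₂ Y Z) c) = t := congrArg Subtype.val hc
    rw [← hc']
    exact (desc_lineIncl_mem_outerSubalgebra hI x y z _).2.2.2.2.2.2
  set x' : coprod X (coprod Y Z) := inl X (coprod Y Z) (lineGen hI 0 x)
  set y' : coprod X (coprod Y Z) := inr X (coprod Y Z) (inl Y Z (lineGen hI 1 y))
  set z' : coprod X (coprod Y Z) := inr X (coprod Y Z) (inr Y Z (lineGen hI 2 z))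
  have hx : f x' = gen 0 x := desc_inl _ _ _
  have hy : f y' = gen 1 y := (desc_inr _ _ _).trans (desc_inl _ _ _)
  have hz : f z' = gen 2 z := (desc_inr _ _ _).trans (desc_inr _ _ _)
  -- Each component of `Σ_{X,Y,Z}` kills one of the three generators, hence every product in which
  -- all three occur.
  have kx : desc 0 (desc (inl Y Z) (inr Y Z)) x' = 0 := by simp [x']
  have ky : desc (inl X Z) (desc 0 (inr X Z)) y' = 0 := by simp [y']
  have kz : desc (inl X Y) (desc (inr X Y) 0) z' = 0 := by simp [z']
  have hker : ∀ t, desc (inl X Y) (desc (inr X Y) 0) t = 0 →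
      desc (inl X Z) (desc 0 (inr X Z)) t = 0 →
      desc 0 (desc (inl Y Z) (inr Y Z)) t = 0 → sigma₃ X Y Z t = 0 :=
    fun t h₁ h₂ h₃ => Prod.ext h₁ (Prod.ext h₂ h₃)
  have e₁ : (1 : Fin 3) + 1 = 2 := rfl
  have e₂ : (1 : Fin 3) + 2 = 0 := rfl
  have e₃ : (2 : Fin 3) + 1 = 0 := rfl
  have e₄ : (2 : Fin 3) + 2 = 1 := rfl
  refine ⟨?_, ?_, ?_, ?_⟩
  -- The cubic coefficient of `(ε₀x · ε₁y) · ε₂z` is exactly `(xy)z`; the other three cases are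
  -- analogous.
  · have := key ((x' * y') * z') (hker _ (by simp [kz]) (by simp [ky]) (by simp [kx]))
    simpa [hx, hy, hz, cubic_mul, quadratic_mul, linear_mul, linear_gen, quadratic_gen,
      Fin.sum_univ_three, e₁, e₂, e₃, e₄] using this
  · have := key ((y' * x') * z') (hker _ (by simp [kz]) (by simp [ky]) (by simp [kx]))
    simpa [hx, hy, hz, cubic_mul, quadratic_mul, linear_mul, linear_gen, quadratic_gen,
      Fin.sum_univ_three, e₁, e₂, e₃, e₄] using this
  · have := key (z' * (x' * y')) (hker _ (by simp [kz]) (by simp [ky]) (by simp [kx]))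
    simpa [hx, hy, hz, cubic_mul, quadratic_mul, linear_mul, linear_gen, quadratic_gen,
      Fin.sum_univ_three, e₁, e₂, e₃, e₄] using this
  · have := key (z' * (y' * x')) (hker _ (by simp [kz]) (by simp [ky]) (by simp [kx]))
    simpa [hx, hy, hz, cubic_mul, quadratic_mul, linear_mul, linear_gen, quadratic_gen,
      Fin.sum_univ_three, e₁, e₂, e₃, e₄] using this

end Necessity

end VarietyAlgebra

/-! ### Free algebras of the variety -/

namespace VarietyAlgebra

open Polarization

variable {K : Type u} [Field K] {σ : Type w}

/-- The values of the polynomials in `I`. -/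
def identityValues (I : Set (FreeNonUnitalNonAssocAlgebra K σ)) (ι : Type*) :
    Set (FreeNonUnitalNonAssocAlgebra K ι) :=
  {p | ∃ φ ∈ I, ∃ a : σ → FreeNonUnitalNonAssocAlgebra K ι,
    p = FreeNonUnitalNonAssocAlgebra.lift K a φ}

/-- The free algebra of the variety on `ι`. -/
noncomputable def free (I : Set (FreeNonUnitalNonAssocAlgebra K σ)) (ι : Type v) :
    VarietyAlgebra.{u, v, w} I where
  carrier := QuotientAlgebra K (identityValues I ι)
  isIdentity φ hφ a := by
    choose b hb using fun i => QuotientAlgebra.mk_surjective _ (a i)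
    obtain rfl : (fun i => QuotientAlgebra.mk K _ (b i)) = a := funext hb
    rw [← comp_lift, ← map_zero (QuotientAlgebra.mk K (identityValues I ι))]
    apply QuotientAlgebra.mk_eq_of_mem
    rw [sub_zero]
    exact ⟨φ, hφ, b, rfl⟩

variable {I : Set (FreeNonUnitalNonAssocAlgebra K σ)}

/-- Only the existence half of freeness is recorded, which is enough to transport an equation
between generators to any algebra. -/
theorem exists_hom_free (ι : Type v) : ∃ g : ι → free I ι, ∀ (A : VarietyAlgebra.{u, v, w} I)
    (a : ι → A), ∃ f : free I ι →ₙₐ[K] A, ∀ i, f (g i) = a i := by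
  refine ⟨fun i => QuotientAlgebra.mk K (identityValues I ι)
    (FreeNonUnitalNonAssocAlgebra.of K i), fun A a => ⟨QuotientAlgebra.lift (identityValues I ι)
      (FreeNonUnitalNonAssocAlgebra.lift K a) ?_, fun i =>
        FreeNonUnitalNonAssocAlgebra.lift_of_apply K a i⟩⟩
  rintro _ ⟨φ, hφ, b, rfl⟩
  rw [comp_lift]
  exact A.isIdentity φ hφ _

end VarietyAlgebra
end Cosmash

/-! ### The equivalence -/

/-- Let `V` be the variety of algebras over the field `K` determined by a set `I` of homogeneous
polynomials. All comparison maps of `V` are surjective if and only if there are coefficients for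
which the four equations pulling `x` out of the parentheses are identities of `V`. -/
theorem proposition7p1 {K : Type u} [Field K] {σ : Type w}
    (I : Set (FreeNonUnitalNonAssocAlgebra K σ)) (hI : ∀ φ ∈ I, Cosmash.IsHomogeneous φ) :
    (∀ X Y Z : Cosmash.VarietyAlgebra.{u, v, w} I,
        Function.Surjective (Cosmash.VarietyAlgebra.comparison X Y Z)) ↔
      ∃ α β γ δ : Fin 4 → K, ∀ A : Cosmash.VarietyAlgebra.{u, v, w} I, ∀ x y z : A,
        (x * y) * z = α 0 • (x * (y * z)) + α 1 • (x * (z * y)) +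
            α 2 • ((y * z) * x) + α 3 • ((z * y) * x) ∧
        (y * x) * z = β 0 • (x * (y * z)) + β 1 • (x * (z * y)) +
            β 2 • ((y * z) * x) + β 3 • ((z * y) * x) ∧
        z * (x * y) = γ 0 • (x * (y * z)) + γ 1 • (x * (z * y)) +
            γ 2 • ((y * z) * x) + γ 3 • ((z * y) * x) ∧
        z * (y * x) = δ 0 • (x * (y * z)) + δ 1 • (x * (z * y)) +
            δ 2 • ((y * z) * x) + δ 3 • ((z * y) * x) := by
  constructor
  · intro h
    -- Coefficients found for three free generators serve every algebra and all its elements.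
    -- `ULift` places the index set in the universe that `free` requires.
    obtain ⟨g, hg⟩ := Cosmash.VarietyAlgebra.exists_hom_free (I := I) (ULift.{v} (Fin 3))
    obtain ⟨h₁, h₂, h₃, h₄⟩ :=
      Cosmash.VarietyAlgebra.mem_outerSpan_of_surjective hI h (g ⟨0⟩) (g ⟨1⟩) (g ⟨2⟩)
    obtain ⟨α, hα⟩ := Cosmash.Polarization.mem_outerSpan.1 h₁
    obtain ⟨β, hβ⟩ := Cosmash.Polarization.mem_outerSpan.1 h₂
    obtain ⟨γ, hγ⟩ := Cosmash.Polarization.mem_outerSpan.1 h₃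
    obtain ⟨δ, hδ⟩ := Cosmash.Polarization.mem_outerSpan.1 h₄
    refine ⟨α, β, γ, δ, fun A x y z => ?_⟩
    obtain ⟨f, hf⟩ := hg A fun i => ![x, y, z] i.down
    have hx : f (g ⟨0⟩) = x := hf _
    have hy : f (g ⟨1⟩) = y := hf _
    have hz : f (g ⟨2⟩) = z := hf _
    replace hα := congrArg f hα
    replace hβ := congrArg f hβ
    replace hγ := congrArg f hγ
    replace hδ := congrArg f hδ
    simp only [map_add, map_smul, map_mul, hx, hy, hz] at hα hβ hγ hδ
    exact ⟨hα, hβ, hγ, hδ⟩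
  · rintro ⟨α, β, γ, δ, h⟩ X Y Z
    -- A subspace containing the four products with `x` outside contains all their combinations,
    -- whatever the coefficients.
    refine Cosmash.VarietyAlgebra.comparison_surjective fun N x y z h₁ h₂ h₃ h₄ => ?_
    have key : ∀ c : Fin 4 → K, c 0 • (x * (y * z)) + c 1 • (x * (z * y)) +
        c 2 • ((y * z) * x) + c 3 • ((z * y) * x) ∈ N := fun c =>
      add_mem (add_mem (add_mem (N.smul_mem _ h₁) (N.smul_mem _ h₂)) (N.smul_mem _ h₃))
        (N.smul_mem _ h₄)
    obtain ⟨e₁, e₂, e₃, e₄⟩ := h _ x y z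
    rw [e₁, e₂, e₃, e₄]
    exact ⟨key α, key β, key γ, key δ⟩
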